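/- Let $p\ge 5$ be a prime, let $n\ge 4$, and let $\epsilon$ be an integer which is either equal to $1$ or a quadratic non-residue modulo $p$. Let $$G=G(n,\epsilon)=\langle A,B,C\mid A^p=B^p=C^{p^{n-2}}=[B,C]=1,\ [A,C^{-1}]=B,\ [B,A]=C^{\epsilon p^{n-3}}\rangle ,\qquad [x,y]=x^{-1}y^{-1}xy,$$ and let $M=\langle B,C\rangle$. Let $\mathrm{Ch}(G)$ denote the Chern ring of $G$, that is, the subring of $H^{\mathrm{even}}(G;\mathbb Z)$ generated by the Chern classes $c_i(\rho)=\rho^*c_i$ ($c_i\in H^{2i}(BU(m);\mathbb Z)$) of all representations $\rho:G\to U(m)$, $m\ge 0$. Then: 1. $G$ has order $p^n$ and $p$-rank two: it contains a subgroup isomorphic to $(C_p)^2$, and $r\le 2$ whenever it contains a subgroup isomorphic to $(C_p)^r$. 2. $\mathrm{Ch}(G)$ is strictly contained in $H^{\mathrm{even}}(G;\mathbb Z)$. 3. $\mathrm{Ch}(G)$ does not map onto $H^*(G;\mathbb Z)$ modulo its nilradical. 4. There is a homomorphism $\theta:M\to U(1)$ with $\theta(B)=\exp(2\pi i/p)$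 and $\theta(C)=1$. Let $\beta'\in H^2(\langle B\rangle;\mathbb Z)$ be the restriction to $\langle B\rangle$ of its first Chern class $c_1(\theta)\in H^2(M;\mathbb Z)$. Then $\beta'^{\,p+1}$ lies in $\mathrm{Res}^G_{\langle B\rangle}(H^{\mathrm{even}}(G;\mathbb Z))$ but not in $\mathrm{Res}^G_{\langle B\rangle}(\mathrm{Ch}(G))$, and $\beta'^{\,p+1}$ is not nilpotent. In particular (by 1 and 2), $G$ is a counterexample to Thomas's conjecture that $\mathrm{Ch}(P)=H^{\mathrm{even}}(P;\mathbb Z)$ for every $p$-group $P$ of $p$-rank two. -/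

import Mathlib

noncomputable section

namespace ChernRing

open CategoryTheory Opposite Simplicial

/-! ### Integral cochains on a simplicial set, with the cup product -/

/-- The operator `X_n → X_m` of a simplicial set attached to a monotone map `[m] → [n]`. -/
def act (X : SSet.{0}) {m n : ℕ} (f : Fin (m + 1) →o Fin (n + 1)) : X _⦋n⦌ → X _⦋m⦌ :=
  fun s => X.map (SimplexCategory.mkHom f).op s

theorem act_act (X : SSet.{0}) {l m n : ℕ} (f : Fin (l + 1) →o Fin (m + 1))
    (g : Fin (m + 1) →o Fin (n + 1)) (s : X _⦋n⦌) :
    act X f (act X g s) = act X (g.comp f) s := by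
  have h : (SimplexCategory.mkHom (g.comp f)) =
      SimplexCategory.mkHom f ≫ SimplexCategory.mkHom g := rfl
  unfold act
  rw [h, op_comp, X.map_comp]
  rfl

theorem act_id (X : SSet.{0}) {n : ℕ} (s : X _⦋n⦌) : act X OrderHom.id s = s := by
  have h : (SimplexCategory.mkHom (OrderHom.id : Fin (n + 1) →o Fin (n + 1))) = 𝟙 _ := rfl
  unfold act
  rw [h, op_id, X.map_id]
  rfl

theorem app_act {X Y : SSet.{0}} (φ : X ⟶ Y) {m n : ℕ} (f : Fin (m + 1) →o Fin (n + 1))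
    (s : X _⦋n⦌) : φ.app (op ⦋m⦌) (act X f s) = act Y f (φ.app (op ⦋n⦌) s) := by
  unfold act
  exact ConcreteCategory.congr_hom (φ.naturality (SimplexCategory.mkHom f).op) s

/-- For `p ≤ n`, the inclusion `[p] → [n]` onto the first `p + 1` vertices. -/
def front (p n : ℕ) : Fin (p + 1) →o Fin (n + 1) where
  toFun i := ⟨min i n, by omega⟩
  monotone' i j h := by
    simp only [Fin.le_def] at h ⊢
    omega

/-- For `q ≤ n`, the inclusion `[q] → [n]` onto the last `q + 1` vertices. -/
def back (q n : ℕ) : Fin (q + 1) →o Fin (n + 1) where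
  toFun i := ⟨min (n - q + i) n, by omega⟩
  monotone' i j h := by
    simp only [Fin.le_def] at h ⊢
    omega

/-- For `i ≤ n + 1`, the injection `[n] → [n + 1]` that misses the vertex `i`. -/
def face (n i : ℕ) : Fin (n + 1) →o Fin (n + 2) where
  toFun j := ⟨if j.1 < i then j.1 else j.1 + 1, by split_ifs <;> omega⟩
  monotone' j k h := by
    simp only [Fin.le_def] at h ⊢
    split_ifs <;> omega

theorem front_val (p n : ℕ) (i : Fin (p + 1)) : (front p n i : ℕ) = min i.1 n := rfl

theorem back_val (q n : ℕ) (i : Fin (q + 1)) : (back q n i : ℕ) = min (n - q + i) n := rfl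

theorem face_val (n j : ℕ) (i : Fin (n + 1)) : (face n j i : ℕ) = if i.1 < j then i.1 else i.1 + 1 := rfl

/-- Sequences of integral cochains `f n : X_n → ℤ`, one in each degree `n`. -/
structure Cochains (X : SSet.{0}) : Type where
  /-- the component of degree `n` -/
  toFun : ∀ n : ℕ, X _⦋n⦌ → ℤ

namespace Cochains

variable {X Y : SSet.{0}}

instance : CoeFun (Cochains X) fun _ => ∀ n : ℕ, X _⦋n⦌ → ℤ := ⟨toFun⟩

@[ext] theorem ext {f g : Cochains X} (h : ∀ n s, f n s = g n s) : f = g := by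
  obtain ⟨f⟩ := f
  obtain ⟨g⟩ := g
  congr
  exact funext fun n => funext fun s => h n s

instance : Zero (Cochains X) := ⟨⟨fun _ _ => 0⟩⟩
instance : Add (Cochains X) := ⟨fun f g => ⟨fun n s => f n s + g n s⟩⟩
instance : Neg (Cochains X) := ⟨fun f => ⟨fun n s => -f n s⟩⟩

theorem add_apply (f g : Cochains X) (n : ℕ) (s : X _⦋n⦌) : (f + g) n s = f n s + g n s := rfl

theorem neg_apply (f : Cochains X) (n : ℕ) (s : X _⦋n⦌) : (-f) n s = -f n s := rfl

theorem zero_apply (n : ℕ) (s : X _⦋n⦌) : (0 : Cochains X) n s = 0 := rfl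

/-- The cup product (Alexander--Whitney formula):
`(f ∪ g)(s) = ∑_{p + q = n} f (front p-face of s) * g (back q-face of s)`. -/
instance : Mul (Cochains X) where
  mul f g := .mk fun n s => ∑ x ∈ Finset.HasAntidiagonal.antidiagonal n,
    f x.1 (act X (front x.1 n) s) * g x.2 (act X (back x.2 n) s)

/-- The unit is the constant cochain `1` in degree `0`. -/
instance : One (Cochains X) where
  one := .mk fun n _ => if n = 0 then 1 else 0

theorem mul_apply (f g : Cochains X) (n : ℕ) (s : X _⦋n⦌) :
    (f * g) n s = ∑ x ∈ Finset.HasAntidiagonal.antidiagonal n,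
      f x.1 (act X (front x.1 n) s) * g x.2 (act X (back x.2 n) s) := rfl

theorem one_apply (n : ℕ) (s : X _⦋n⦌) : (1 : Cochains X) n s = if n = 0 then 1 else 0 := rfl

theorem front_self (n : ℕ) : front n n = OrderHom.id := by
  ext i
  simp only [front_val, OrderHom.id_coe, id]
  omega

theorem back_self (n : ℕ) : back n n = OrderHom.id := by
  ext i
  simp only [back_val, OrderHom.id_coe, id]
  omega

theorem front_front {a p n : ℕ} (h : p ≤ a) (h' : a ≤ n) :
    (front a n).comp (front p a) = front p n := by
  ext i
  simp only [front_val, OrderHom.comp_coe, Function.comp]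
  omega

theorem back_back {b r n : ℕ} (h : r ≤ b) (h' : b ≤ n) :
    (back b n).comp (back r b) = back r n := by
  ext i
  simp only [back_val, OrderHom.comp_coe, Function.comp]
  omega

theorem front_back {p q r n : ℕ} (h : p + q + r = n) :
    (front (p + q) n).comp (back q (p + q)) = (back (q + r) n).comp (front q (q + r)) := by
  ext i
  simp only [front_val, back_val, OrderHom.comp_coe, Function.comp]
  omega

protected theorem mul_assoc (f g h : Cochains X) : f * g * h = f * (g * h) := by
  ext n s
  simp only [mul_apply, Finset.sum_mul, Finset.mul_sum, act_act]
  rw [Finset.sum_sigma', Finset.sum_sigma']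
  refine Finset.sum_nbij' (fun x => ⟨(x.2.1, x.2.2 + x.1.2), (x.2.2, x.1.2)⟩)
    (fun x => ⟨(x.1.1 + x.2.1, x.2.2), (x.1.1, x.2.1)⟩) ?_ ?_ ?_ ?_ ?_
  · rintro ⟨⟨a, r⟩, ⟨p, q⟩⟩ hx
    simp only [Finset.mem_sigma, Finset.HasAntidiagonal.mem_antidiagonal] at hx ⊢
    exact ⟨by omega, trivial⟩
  · rintro ⟨⟨a, r⟩, ⟨p, q⟩⟩ hx
    simp only [Finset.mem_sigma, Finset.HasAntidiagonal.mem_antidiagonal] at hx ⊢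
    exact ⟨by omega, trivial⟩
  · rintro ⟨⟨a, r⟩, ⟨p, q⟩⟩ hx
    simp only [Finset.mem_sigma, Finset.HasAntidiagonal.mem_antidiagonal] at hx ⊢
    obtain ⟨h1, h2⟩ := hx
    subst h2
    rfl
  · rintro ⟨⟨a, r⟩, ⟨p, q⟩⟩ hx
    simp only [Finset.mem_sigma, Finset.HasAntidiagonal.mem_antidiagonal] at hx ⊢
    obtain ⟨h1, h2⟩ := hx
    subst h2
    rfl
  · rintro ⟨⟨a, r⟩, ⟨p, q⟩⟩ hx
    simp only [Finset.mem_sigma, Finset.HasAntidiagonal.mem_antidiagonal] at hx ⊢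
    obtain ⟨h1, h2⟩ := hx
    subst h2
    rw [front_front (by omega) (by omega), front_back h1, back_back (by omega) (by omega),
      mul_assoc]

instance : Ring (Cochains X) :=
  { add_assoc := fun f g h => by
      ext n s
      simp only [add_apply, add_assoc]
    zero_add := fun f => by
      ext n s
      simp only [add_apply, zero_apply, zero_add]
    add_zero := fun f => by
      ext n s
      simp only [add_apply, zero_apply, add_zero]
    add_comm := fun f g => by
      ext n s
      simp only [add_apply, add_comm]
    neg_add_cancel := fun f => by
      ext n s
      simp only [add_apply, neg_apply, zero_apply, neg_add_cancel]
    mul_assoc := Cochains.mul_assoc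
    left_distrib := fun f g h => by
      ext n s
      simp only [mul_apply, add_apply, mul_add, Finset.sum_add_distrib]
    right_distrib := fun f g h => by
      ext n s
      simp only [mul_apply, add_apply, add_mul, Finset.sum_add_distrib]
    zero_mul := fun f => by
      ext n s
      simp only [mul_apply, zero_apply, zero_mul, Finset.sum_const_zero]
    mul_zero := fun f => by
      ext n s
      simp only [mul_apply, zero_apply, mul_zero, Finset.sum_const_zero]
    one_mul := fun f => by
      ext n s
      rw [mul_apply, Finset.sum_eq_single (0, n)]
      · simp [one_apply, back_self, act_id]
      · rintro ⟨a, b⟩ hx hne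
        have : a ≠ 0 := by
          rintro rfl
          apply hne
          simpa using hx
        simp [one_apply, this]
      · simp
    mul_one := fun f => by
      ext n s
      rw [mul_apply, Finset.sum_eq_single (n, 0)]
      · simp [one_apply, front_self, act_id]
      · rintro ⟨a, b⟩ hx hne
        have : b ≠ 0 := by
          rintro rfl
          apply hne
          simpa using hx
        simp [one_apply, this]
      · simp
    zsmul := zsmulRec
    nsmul := nsmulRec }

/-- The simplicial coboundary: `(d f)(s) = ∑_{i ≤ n + 1} (-1)^i f (d_i s)` for `s ∈ X_{n+1}`. -/
def d : Cochains X →+ Cochains X where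
  toFun f := .mk fun n =>
    match n with
    | 0 => fun _ => 0
    | n + 1 => fun s => ∑ i ∈ Finset.range (n + 2), (-1) ^ i * f n (act X (face n i) s)
  map_zero' := by
    ext n s
    rcases n with _ | n
    · rfl
    · simp only [zero_apply, mul_zero, Finset.sum_const_zero]
  map_add' f g := by
    ext n s
    rcases n with _ | n
    · rfl
    · simp only [add_apply, mul_add, Finset.sum_add_distrib]

theorem d_zero_apply (f : Cochains X) (s : X _⦋0⦌) : d f 0 s = 0 := rfl

theorem d_succ_apply (f : Cochains X) (n : ℕ) (s : X _⦋n + 1⦌) :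
    d f (n + 1) s = ∑ i ∈ Finset.range (n + 2), (-1) ^ i * f n (act X (face n i) s) := rfl

/-- The sign automorphism: multiplication by `(-1)^n` in degree `n`. -/
def sgn (f : Cochains X) : Cochains X := .mk fun n s => (-1) ^ n * f n s

theorem sgn_apply (f : Cochains X) (n : ℕ) (s : X _⦋n⦌) : sgn f n s = (-1) ^ n * f n s := rfl

theorem sgn_sgn (f : Cochains X) : sgn (sgn f) = f := by
  ext n s
  simp only [sgn_apply, ← mul_assoc, ← mul_pow]
  simp

theorem d_sgn (f : Cochains X) : d (sgn f) = -sgn (d f) := by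
  ext n s
  cases n with
  | zero => simp [neg_apply, sgn_apply, d_zero_apply]
  | succ n =>
    simp only [neg_apply, sgn_apply, d_succ_apply, Finset.mul_sum, ← Finset.sum_neg_distrib]
    refine Finset.sum_congr rfl fun i _ => ?_
    ring

theorem face_front_le {p q i : ℕ} (h : i ≤ p) :
    (face (p + q) i).comp (front p (p + q)) = (front (p + 1) (p + q + 1)).comp (face p i) := by
  ext j
  simp only [front_val, face_val, OrderHom.comp_coe, Function.comp]
  grind

theorem face_back_le {p q i : ℕ} (h : i ≤ p) :
    (face (p + q) i).comp (back q (p + q)) = back q (p + q + 1) := by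
  ext j
  simp only [back_val, face_val, OrderHom.comp_coe, Function.comp]
  grind

theorem face_front_gt {p q j : ℕ} :
    (face (p + q) (p + 1 + j)).comp (front p (p + q)) = front p (p + q + 1) := by
  ext j
  simp only [front_val, face_val, OrderHom.comp_coe, Function.comp]
  grind

theorem face_back_gt {p q j : ℕ} :
    (face (p + q) (p + 1 + j)).comp (back q (p + q)) =
      (back (q + 1) (p + q + 1)).comp (face q (j + 1)) := by
  ext j
  simp only [back_val, face_val, OrderHom.comp_coe, Function.comp]
  grind

theorem front_face_last {p n : ℕ} (_h : p ≤ n) :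
    (front (p + 1) (n + 1)).comp (face p (p + 1)) = front p (n + 1) := by
  ext j
  simp only [front_val, face_val, OrderHom.comp_coe, Function.comp]
  grind

theorem back_face_zero {q n : ℕ} (h : q ≤ n) :
    (back (q + 1) (n + 1)).comp (face q 0) = back q (n + 1) := by
  ext j
  simp only [back_val, face_val, OrderHom.comp_coe, Function.comp]
  grind

/-- The Leibniz rule. -/
theorem d_mul (f g : Cochains X) : d (f * g) = d f * g + sgn f * d g := by
  ext n s
  cases n with
  | zero => simp [add_apply, mul_apply, d_zero_apply]
  | succ n =>
    rw [add_apply, mul_apply, mul_apply, Finset.Nat.sum_antidiagonal_succ,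
      Finset.Nat.sum_antidiagonal_succ']
    simp only [d_zero_apply, zero_mul, mul_zero, zero_add, d_succ_apply, mul_apply,
      Finset.mul_sum, Finset.sum_mul, act_act]
    rw [Finset.sum_comm, ← Finset.sum_add_distrib]
    refine Finset.sum_congr rfl ?_
    rintro ⟨p, q⟩ hx
    rw [Finset.HasAntidiagonal.mem_antidiagonal] at hx
    dsimp only at hx ⊢
    subst hx
    have key : ∀ F : ℕ → ℤ, ∑ i ∈ Finset.range (p + q + 2), F i =
        ∑ i ∈ Finset.range (p + 1), F i + ∑ j ∈ Finset.range (q + 1), F (p + 1 + j) := by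
      intro F
      rw [show p + q + 2 = (p + 1) + (q + 1) by ring, Finset.sum_range_add]
    rw [key, Finset.sum_range_succ _ (p + 1), Finset.sum_range_succ' _ (q + 1)]
    rw [front_face_last (by omega), back_face_zero (by omega)]
    have h1 : ∀ i ∈ Finset.range (p + 1),
        (-1) ^ i * (f p (act X ((face (p + q) i).comp (front p (p + q))) s) *
          g q (act X ((face (p + q) i).comp (back q (p + q))) s)) =
        (-1) ^ i * f p (act X ((front (p + 1) (p + q + 1)).comp (face p i)) s) *
          g q (act X (back q (p + q + 1)) s) := by
      intro i hi
      rw [Finset.mem_range] at hi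
      rw [face_front_le (by omega), face_back_le (by omega)]
      ring
    have h2 : ∀ j ∈ Finset.range (q + 1),
        (-1) ^ (p + 1 + j) * (f p (act X ((face (p + q) (p + 1 + j)).comp (front p (p + q))) s) *
          g q (act X ((face (p + q) (p + 1 + j)).comp (back q (p + q))) s)) =
        sgn f p (act X (front p (p + q + 1)) s) *
          ((-1) ^ (j + 1) *
            g q (act X ((back (q + 1) (p + q + 1)).comp (face q (j + 1))) s)) := by
      intro j _
      rw [face_front_gt, face_back_gt, sgn_apply]
      ring
    rw [Finset.sum_congr rfl h1, Finset.sum_congr rfl h2, sgn_apply]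
    ring

theorem d_one : d (1 : Cochains X) = 0 := by
  ext n s
  cases n with
  | zero => rfl
  | succ n =>
    rw [d_succ_apply, zero_apply]
    cases n with
    | zero => simp [one_apply, Finset.sum_range_succ]
    | succ n => simp [one_apply]

/-- A sequence of cochains is bounded if it vanishes in all large degrees. -/
def IsBounded (f : Cochains X) : Prop := ∃ N : ℕ, ∀ n, N ≤ n → f n = 0

theorem IsBounded.sgn {f : Cochains X} (hf : IsBounded f) : IsBounded (sgn f) := by
  obtain ⟨N, hN⟩ := hf
  refine ⟨N, fun n hn => funext fun s => ?_⟩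
  simp [sgn_apply, hN n hn]

theorem IsBounded.add {f g : Cochains X} (hf : IsBounded f) (hg : IsBounded g) :
    IsBounded (f + g) := by
  obtain ⟨N, hN⟩ := hf
  obtain ⟨M, hM⟩ := hg
  refine ⟨max N M, fun n hn => funext fun s => ?_⟩
  rw [add_apply, hN n (le_of_max_le_left hn), hM n (le_of_max_le_right hn)]
  rfl

theorem IsBounded.neg {f : Cochains X} (hf : IsBounded f) : IsBounded (-f) := by
  obtain ⟨N, hN⟩ := hf
  refine ⟨N, fun n hn => funext fun s => ?_⟩
  rw [neg_apply, hN n hn]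
  rfl

theorem IsBounded.mul {f g : Cochains X} (hf : IsBounded f) (hg : IsBounded g) :
    IsBounded (f * g) := by
  obtain ⟨N, hN⟩ := hf
  obtain ⟨M, hM⟩ := hg
  refine ⟨N + M, fun n hn => funext fun s => ?_⟩
  rw [mul_apply]
  refine Finset.sum_eq_zero ?_
  rintro ⟨a, b⟩ hx
  rw [Finset.HasAntidiagonal.mem_antidiagonal] at hx
  dsimp only at hx ⊢
  by_cases ha : N ≤ a
  · simp [hN a ha]
  · simp [hM b (by omega)]

/-- The pull-back of cochains along a map of simplicial sets. -/
def pull (φ : X ⟶ Y) : Cochains Y →+* Cochains X where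
  toFun f := .mk fun n s => f n (φ.app (op ⦋n⦌) s)
  map_zero' := rfl
  map_one' := rfl
  map_add' _ _ := rfl
  map_mul' f g := by
    ext n s
    simp only [mul_apply, app_act]

theorem pull_apply (φ : X ⟶ Y) (f : Cochains Y) (n : ℕ) (s : X _⦋n⦌) :
    pull φ f n s = f n (φ.app (op ⦋n⦌) s) := rfl

theorem d_pull (φ : X ⟶ Y) (f : Cochains Y) : d (pull φ f) = pull φ (d f) := by
  ext n s
  cases n with
  | zero => rfl
  | succ n => simp only [d_succ_apply, pull_apply, app_act]

theorem IsBounded.pull (φ : X ⟶ Y) {f : Cochains Y} (hf : IsBounded f) :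
    IsBounded (pull φ f) := by
  obtain ⟨N, hN⟩ := hf
  refine ⟨N, fun n hn => funext fun s => ?_⟩
  rw [pull_apply, hN n hn]
  rfl

end Cochains

open Cochains

/-! ### The integral cohomology ring of a simplicial set -/

/-- The ring of (finite sums of) cocycles. -/
def Cocycles (X : SSet.{0}) : Subring (Cochains X) where
  carrier := {f | IsBounded f ∧ d f = 0}
  zero_mem' := ⟨⟨0, fun _ _ => rfl⟩, map_zero d⟩
  one_mem' := ⟨⟨1, fun n hn => funext fun s => by
    rw [one_apply, if_neg (by omega)]; rfl⟩, d_one⟩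
  add_mem' := fun {f g} hf hg => ⟨hf.1.add hg.1, by rw [map_add, hf.2, hg.2, add_zero]⟩
  neg_mem' := fun {f} hf => ⟨hf.1.neg, by rw [map_neg, hf.2, neg_zero]⟩
  mul_mem' := fun {f g} hf hg => ⟨hf.1.mul hg.1, by
    rw [d_mul, hf.2, hg.2, zero_mul, mul_zero, add_zero]⟩

/-- The two-sided ideal of coboundaries in the ring of cocycles. -/
def Coboundaries (X : SSet.{0}) : Ideal (Cocycles X) where
  carrier := {z | ∃ y : Cochains X, IsBounded y ∧ d y = z.1}
  zero_mem' := ⟨0, ⟨0, fun _ _ => rfl⟩, map_zero d⟩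
  add_mem' := by
    rintro a b ⟨y, hy, hya⟩ ⟨w, hw, hwb⟩
    exact ⟨y + w, hy.add hw, by rw [map_add, hya, hwb]; rfl⟩
  smul_mem' := by
    rintro c z ⟨y, hy, hyz⟩
    refine ⟨sgn c.1 * y, c.2.1.sgn.mul hy, ?_⟩
    rw [d_mul, d_sgn, sgn_sgn, c.2.2, hyz]
    have : sgn (0 : Cochains X) = 0 := by
      ext n s
      simp [sgn_apply, zero_apply]
    rw [this, neg_zero, zero_mul, zero_add]
    rfl

instance (X : SSet.{0}) : (Coboundaries X).IsTwoSided where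
  mul_mem_of_left := by
    rintro z c ⟨y, hy, hyz⟩
    refine ⟨y * c.1, hy.mul c.2.1, ?_⟩
    rw [d_mul, hyz, c.2.2, mul_zero, add_zero]
    rfl

/-- The integral cohomology ring `H^*(X; ℤ) = ⨁ₙ H^n(X; ℤ)` of a simplicial set. -/
def H (X : SSet.{0}) : Type := Cocycles X ⧸ Coboundaries X

instance (X : SSet.{0}) : Ring (H X) := inferInstanceAs (Ring (Cocycles X ⧸ Coboundaries X))

/-- The cohomology class of a cocycle. -/
def H.mk (X : SSet.{0}) : Cocycles X →+* H X := Ideal.Quotient.mk (Coboundaries X)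

/-- The subgroup `H^k(X; ℤ)` of classes of degree `k`. -/
def H.degree (X : SSet.{0}) (k : ℕ) : AddSubgroup (H X) where
  carrier := {x | ∃ z : Cocycles X, (∀ n, n ≠ k → z.1 n = 0) ∧ H.mk X z = x}
  zero_mem' := ⟨0, fun _ _ => rfl, map_zero _⟩
  add_mem' := by
    rintro _ _ ⟨z, hz, rfl⟩ ⟨w, hw, rfl⟩
    refine ⟨z + w, fun n hn => funext fun s => ?_, map_add _ _ _⟩
    change z.1 n s + w.1 n s = 0
    rw [hz n hn, hw n hn]
    rfl
  neg_mem' := by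
    rintro _ ⟨z, hz, rfl⟩
    refine ⟨-z, fun n hn => funext fun s => ?_, map_neg _ _⟩
    change -z.1 n s = 0
    rw [hz n hn]
    rfl

/-- The subring `H^even(X; ℤ) = ⨁ₖ H^{2k}(X; ℤ)`. -/
def H.even (X : SSet.{0}) : Subring (H X) where
  carrier := {x | ∃ z : Cocycles X, (∀ n, Odd n → z.1 n = 0) ∧ H.mk X z = x}
  zero_mem' := ⟨0, fun _ _ => rfl, map_zero _⟩
  one_mem' := ⟨1, fun n hn => funext fun s => by
    change (if n = 0 then (1 : ℤ) else 0) = 0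
    rw [if_neg]
    rintro rfl
    simp at hn, map_one _⟩
  add_mem' := by
    rintro _ _ ⟨z, hz, rfl⟩ ⟨w, hw, rfl⟩
    refine ⟨z + w, fun n hn => funext fun s => ?_, map_add _ _ _⟩
    change z.1 n s + w.1 n s = 0
    rw [hz n hn, hw n hn]
    rfl
  neg_mem' := by
    rintro _ ⟨z, hz, rfl⟩
    refine ⟨-z, fun n hn => funext fun s => ?_, map_neg _ _⟩
    change -z.1 n s = 0
    rw [hz n hn]
    rfl
  mul_mem' := by
    rintro _ _ ⟨z, hz, rfl⟩ ⟨w, hw, rfl⟩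
    refine ⟨z * w, fun n hn => funext fun s => ?_, map_mul _ _ _⟩
    change (z.1 * w.1) n s = 0
    rw [mul_apply]
    refine Finset.sum_eq_zero ?_
    rintro ⟨a, b⟩ hx
    rw [Finset.HasAntidiagonal.mem_antidiagonal] at hx
    dsimp only at hx ⊢
    rcases Nat.even_or_odd a with ha | ha
    · have hb : Odd b := by
        by_contra hb
        rw [Nat.not_odd_iff_even] at hb
        exact (Nat.not_even_iff_odd.mpr hn) (hx ▸ ha.add hb)
      simp [hw b hb]
    · simp [hz a ha]

/-- The ring homomorphism `φ^* : H^*(Y; ℤ) → H^*(X; ℤ)` induced by `φ : X → Y`. -/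
def H.pull {X Y : SSet.{0}} (φ : X ⟶ Y) : H Y →+* H X :=
  Ideal.Quotient.lift (Coboundaries Y)
    ((H.mk X).comp ((Cochains.pull φ).restrict (Cocycles Y) (Cocycles X)
      fun f hf => ⟨hf.1.pull φ, by rw [d_pull, hf.2, map_zero]⟩))
    (by
      rintro a ⟨y, hy, hya⟩
      exact Ideal.Quotient.eq_zero_iff_mem.mpr
        ⟨Cochains.pull φ y, hy.pull φ, by rw [d_pull, hya]; rfl⟩)

/-! ### Classifying spaces -/

/-- The classifying space of a discrete group `G`: the nerve of `G`. An `n`-simplex is a functor from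
the poset `[n]` to `G`, written as the family of its values `g i j` (for `i ≤ j` the value on the arrow
`i → j`, for `i > j` the inverse of `g j i`); it is determined by the arbitrary tuple
`(g 0 1, g 1 2, …, g (n-1) n)` in `G ^ n`. -/
def BDisc (G : Type) [Group G] : SSet.{0} where
  obj n := {g : Fin (n.unop.len + 1) → Fin (n.unop.len + 1) → G // ∀ i j k, g i j * g j k = g i k}
  map f := TypeCat.ofHom fun g =>
    ⟨fun i j => g.1 (f.unop.toOrderHom i) (f.unop.toOrderHom j), fun _ _ _ => g.2 _ _ _⟩

/-- The standard topological `n`-simplex. -/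
abbrev Simplex (n : ℕ) : Type := stdSimplex ℝ (Fin (n + 1))

/-- The map of topological simplices induced by a map of vertices. -/
def simplexMap {m n : ℕ} (f : Fin (m + 1) → Fin (n + 1)) : C(Simplex m, Simplex n) :=
  ⟨stdSimplex.map f, stdSimplex.continuous_map f⟩

/-- The classifying space of a topological group `K`, as a simplicial set: the diagonal of the nerve
of the simplicial group of singular simplices of `K`. An `n`-simplex is an `n`-simplex of the nerve
of the group of continuous maps from the topological `n`-simplex to `K`. -/
def BTop (K : Type) [Group K] [TopologicalSpace K] : SSet.{0} where
  obj n := {g : Fin (n.unop.len + 1) → Fin (n.unop.len + 1) → C(Simplex n.unop.len, K) //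
    ∀ i j k t, g i j t * g j k t = g i k t}
  map f := TypeCat.ofHom fun g =>
    ⟨fun i j => (g.1 (f.unop.toOrderHom i) (f.unop.toOrderHom j)).comp
      (simplexMap f.unop.toOrderHom), fun _ _ _ _ => g.2 _ _ _ _⟩
  map_id n := by
    refine ConcreteCategory.hom_ext _ _ fun g => ?_
    refine Subtype.ext (funext fun i => funext fun j => ?_)
    have h : simplexMap (id : Fin (n.unop.len + 1) → Fin (n.unop.len + 1)) = ContinuousMap.id _ :=
      ContinuousMap.ext fun t => stdSimplex.map_id_apply t
    change (g.1 i j).comp (simplexMap id) = g.1 i j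
    rw [h, ContinuousMap.comp_id]
  map_comp f h := by
    refine ConcreteCategory.hom_ext _ _ fun g => ?_
    refine Subtype.ext (funext fun i => funext fun j => ContinuousMap.ext fun t => ?_)
    change g.1 _ _ (stdSimplex.map (f.unop.toOrderHom ∘ h.unop.toOrderHom) t) =
      g.1 _ _ (stdSimplex.map f.unop.toOrderHom (stdSimplex.map h.unop.toOrderHom t))
    rw [stdSimplex.map_comp_apply]
    rfl

/-- The map of classifying spaces induced by a homomorphism of discrete groups. -/
def BDisc.map {G G' : Type} [Group G] [Group G'] (f : G →* G') : BDisc G ⟶ BDisc G' where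
  app n := TypeCat.ofHom fun g => ⟨fun i j => f (g.1 i j), fun i j k => by
    rw [← map_mul, g.2]⟩

/-- The map of classifying spaces induced by a continuous homomorphism of topological groups. -/
def BTop.map {K L : Type} [Group K] [TopologicalSpace K] [Group L] [TopologicalSpace L]
    (f : K →ₜ* L) : BTop K ⟶ BTop L where
  app n := TypeCat.ofHom fun g => ⟨fun i j => (f : C(K, L)).comp (g.1 i j), fun i j k t => by
    change f (g.1 i j t) * f (g.1 j k t) = f (g.1 i k t)
    rw [← map_mul, g.2]⟩

/-- The map of classifying spaces induced by a homomorphism from a discrete group to a topological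
group. -/
def BDisc.toTop {G K : Type} [Group G] [Group K] [TopologicalSpace K] (f : G →* K) :
    BDisc G ⟶ BTop K where
  app n := TypeCat.ofHom fun g => ⟨fun i j => ContinuousMap.const _ (f (g.1 i j)), fun i j k t => by
    change f (g.1 i j) * f (g.1 j k) = f (g.1 i k)
    rw [← map_mul, g.2]⟩

/-- The integral cohomology ring `H^*(G; ℤ)` of a discrete group. -/
abbrev HGrp (G : Type) [Group G] : Type := H (BDisc G)

/-- The homomorphism `f^* : H^*(G'; ℤ) → H^*(G; ℤ)` induced by `f : G → G'`. -/
def HGrp.map {G G' : Type} [Group G] [Group G'] (f : G →* G') : HGrp G' →+* HGrp G :=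
  H.pull (BDisc.map f)

/-- Restriction `H^*(G; ℤ) → H^*(S; ℤ)` to a subgroup `S`. -/
def res {G : Type} [Group G] (S : Subgroup G) : HGrp G →+* HGrp S := HGrp.map S.subtype

/-! ### The first Chern class of the circle group -/

/-- The number `a ∈ (-1/2, 1/2]` such that `z = exp (2 π i a)`. -/
def angle (z : Circle) : ℝ := Complex.arg z / (2 * Real.pi)

theorem exp_angle (z : Circle) : Circle.exp (2 * Real.pi * angle z) = z := by
  rw [angle, mul_div_cancel₀ _ (by positivity), Circle.exp_arg]

/-- Every singular simplex of the circle lifts to the real line. -/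
theorem exists_lift {n : ℕ} (σ : C(Simplex n, Circle)) :
    ∃ l : C(Simplex n, ℝ), ∀ t, Circle.exp (2 * Real.pi * l t) = σ t := by
  have : ContractibleSpace (Simplex n) :=
    (convex_stdSimplex ℝ (Fin (n + 1))).contractibleSpace ⟨_, (stdSimplex.vertex 0).2⟩
  obtain ⟨y, ⟨F⟩⟩ := id_nullhomotopic (Simplex n)
  let F' := F.symm
  obtain ⟨e, he⟩ := Circle.exp_surjective (σ y)
  let K : C(unitInterval × Simplex n, Circle) := σ.comp F'.toContinuousMap
  have h0 : ∀ a, K (0, a) = Circle.exp (ContinuousMap.const (Simplex n) e a) := by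
    intro a
    change σ (F' (0, a)) = Circle.exp e
    rw [F'.apply_zero, he]
    rfl
  let L := Circle.isCoveringMap_exp.liftHomotopy K (ContinuousMap.const _ e) h0
  have hL : ∀ x, Circle.exp (L x) = K x := fun x =>
    congrFun (Circle.isCoveringMap_exp.liftHomotopy_lifts K (ContinuousMap.const _ e) h0) x
  refine ⟨⟨fun t => L (1, t) / (2 * Real.pi), by fun_prop⟩, fun t => ?_⟩
  change Circle.exp (2 * Real.pi * (L (1, t) / (2 * Real.pi))) = σ t
  rw [mul_div_cancel₀ _ (by positivity), hL]
  change σ (F' (1, t)) = σ t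
  rw [F'.apply_one]
  rfl

/-- The displacement, measured in full turns, from the vertex `i` to the vertex `j` of a real lift of
a singular simplex of the circle. -/
def disp {n : ℕ} (σ : C(Simplex n, Circle)) (i j : Fin (n + 1)) : ℝ :=
  (exists_lift σ).choose (stdSimplex.vertex j) - (exists_lift σ).choose (stdSimplex.vertex i)

/-- The displacement can be computed with any lift. -/
theorem disp_eq {n : ℕ} {σ : C(Simplex n, Circle)} (l : C(Simplex n, ℝ))
    (hl : ∀ t, Circle.exp (2 * Real.pi * l t) = σ t) (i j : Fin (n + 1)) :
    disp σ i j = l (stdSimplex.vertex j) - l (stdSimplex.vertex i) := by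
  have hk := (exists_lift σ).choose_spec
  unfold disp
  generalize (exists_lift σ).choose = k at hk
  have : PathConnectedSpace (Simplex n) := inferInstance
  let v : Simplex n := stdSimplex.vertex i
  have h := Circle.isCoveringMap_exp.eq_of_comp_eq (A := Simplex n)
    (g₁ := fun t => 2 * Real.pi * k t)
    (g₂ := fun t => 2 * Real.pi * l t + (2 * Real.pi * k v - 2 * Real.pi * l v))
    (by fun_prop) (by fun_prop)
    (by
      funext t
      change Circle.exp (2 * Real.pi * k t) =
        Circle.exp (2 * Real.pi * l t + (2 * Real.pi * k v - 2 * Real.pi * l v))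
      rw [Circle.exp_add, Circle.exp_sub, hk, hl, hk, hl, div_self', mul_one]) v (by ring)
  have h1 := congrFun h (stdSimplex.vertex j)
  have hpi : (2 * Real.pi) ≠ 0 := by positivity
  have h2 : 2 * Real.pi * (k (stdSimplex.vertex j) - k v) =
      2 * Real.pi * (l (stdSimplex.vertex j) - l v) := by
    linarith
  exact mul_left_cancel₀ hpi h2

theorem disp_comp {m n : ℕ} (σ : C(Simplex n, Circle)) (f : Fin (m + 1) → Fin (n + 1))
    (i j : Fin (m + 1)) : disp (σ.comp (simplexMap f)) i j = disp σ (f i) (f j) := by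
  obtain ⟨l, hl⟩ := exists_lift σ
  rw [disp_eq l hl, disp_eq (l.comp (simplexMap f)) (fun t => hl _)]
  change l (stdSimplex.map f _) - l (stdSimplex.map f _) = _
  rw [stdSimplex.map_vertex, stdSimplex.map_vertex]

theorem disp_mul {n : ℕ} {σ τ υ : C(Simplex n, Circle)} (h : ∀ t, σ t * τ t = υ t)
    (i j : Fin (n + 1)) : disp υ i j = disp σ i j + disp τ i j := by
  obtain ⟨l, hl⟩ := exists_lift σ
  obtain ⟨k, hk⟩ := exists_lift τ
  rw [disp_eq l hl, disp_eq k hk, disp_eq (l + k) (fun t => by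
    rw [ContinuousMap.add_apply, mul_add, Circle.exp_add, hl, hk, h])]
  simp only [ContinuousMap.add_apply]
  ring

theorem disp_trans {n : ℕ} (σ : C(Simplex n, Circle)) (i j k : Fin (n + 1)) :
    disp σ i j + disp σ j k = disp σ i k := by
  unfold disp
  ring

theorem exp_disp {n : ℕ} (σ : C(Simplex n, Circle)) (i j : Fin (n + 1)) :
    Circle.exp (2 * Real.pi * disp σ i j) * σ (stdSimplex.vertex i) =
      σ (stdSimplex.vertex j) := by
  obtain ⟨l, hl⟩ := exists_lift σ
  rw [disp_eq l hl, ← hl, ← hl, ← Circle.exp_add]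
  congr 1
  ring

/-- The integer attached to a `2`-simplex of the classifying space of the circle, as a real number:
lift `g 0 1`, `g 1 2` and `g 0 2` to real functions along the edges `01`, `12` and `02` respectively,
with the value given by `angle` at the initial vertex of each edge, extend the lifts over the whole
simplex, and take the first plus the second minus the third. -/
def turn (g : BTop Circle _⦋2⦌) : ℝ :=
  angle (g.1 (0 : Fin 3) (1 : Fin 3) (stdSimplex.vertex (0 : Fin 3))) +
    angle (g.1 (1 : Fin 3) (2 : Fin 3) (stdSimplex.vertex (1 : Fin 3))) -
    disp (n := 2) (g.1 (1 : Fin 3) (2 : Fin 3)) 0 1 -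
    angle (g.1 (0 : Fin 3) (2 : Fin 3) (stdSimplex.vertex (0 : Fin 3)))

theorem exists_turn (g : BTop Circle _⦋2⦌) : ∃ m : ℤ, turn g = m := by
  have h : Circle.exp (2 * Real.pi * turn g) = 1 := by
    unfold turn
    rw [mul_sub, mul_sub, mul_add, Circle.exp_sub, Circle.exp_sub, Circle.exp_add, exp_angle,
      exp_angle, exp_angle, ← g.2 0 1 2, ← exp_disp (n := 2) (g.1 1 2) 0 1]
    simp only [div_eq_iff_eq_mul]
    rw [one_mul, mul_comm (Circle.exp _)]
    exact (mul_assoc _ _ _).symm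
  obtain ⟨m, hm⟩ := Circle.exp_eq_one.mp h
  refine ⟨m, ?_⟩
  have hpi : (2 * Real.pi) ≠ 0 := by positivity
  refine mul_left_cancel₀ hpi ?_
  rw [hm, mul_comm]

/-- The `2`-cocycle representing the first Chern class of the circle group. On a `2`-simplex of
constant maps it is the cocycle `angle a + angle b - angle (a * b)` of the extension
`ℤ → ℝ → U(1)`. -/
def chernCochain : Cochains (BTop Circle) where
  toFun n := match n with
    | 2 => fun g => ⌊turn g⌋
    | _ => fun _ => 0

theorem chernCochain_two (g : BTop Circle _⦋2⦌) : (chernCochain 2 g : ℝ) = turn g := by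
  change ((⌊turn g⌋ : ℤ) : ℝ) = turn g
  obtain ⟨m, hm⟩ := exists_turn g
  rw [hm, Int.floor_intCast]

theorem chernCochain_ne (n : ℕ) (hn : n ≠ 2) : chernCochain n = fun _ => 0 := by
  match n, hn with
  | 0, _ => rfl
  | 1, _ => rfl
  | n + 3, _ => rfl

theorem turn_act (g : BTop Circle _⦋3⦌) (f : Fin 3 →o Fin 4) :
    turn (act (BTop Circle) f g) =
      angle (g.1 (f 0) (f 1) (stdSimplex.vertex (f 0))) +
      angle (g.1 (f 1) (f 2) (stdSimplex.vertex (f 1))) -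
      disp (n := 3) (g.1 (f 1) (f 2)) (f 0) (f 1) -
      angle (g.1 (f 0) (f 2) (stdSimplex.vertex (f 0))) := by
  have e : ∀ i j : Fin 3, (act (BTop Circle) f g).1 i j =
    (g.1 (f i) (f j)).comp (simplexMap (m := 2) (n := 3) f) := fun i j => rfl
  have hv : ∀ (σ : C(Simplex 3, Circle)) (i : Fin 3),
      (σ.comp (simplexMap (m := 2) (n := 3) f)) (stdSimplex.vertex i) =
        σ (stdSimplex.vertex (f i)) := by
    intro σ i
    change σ (stdSimplex.map f _) = _
    rw [stdSimplex.map_vertex]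
  unfold turn
  rw [e, e, e]
  erw [hv, hv, hv, disp_comp]

theorem d_chernCochain : d chernCochain = 0 := by
  ext n s
  rw [zero_apply]
  rcases n with _ | n
  · rfl
  rw [d_succ_apply]
  by_cases hn : n = 2
  · subst hn
    have h : ((∑ i ∈ Finset.range 4, (-1) ^ i *
        chernCochain 2 (act (BTop Circle) (face 2 i) s) : ℤ) : ℝ) = 0 := by
      push_cast
      simp only [Finset.sum_range_succ, Finset.sum_range_zero, chernCochain_two, turn_act]
      have h0 : (face 2 0 0, face 2 0 1, face 2 0 2) = ((1, 2, 3) : Fin 4 × Fin 4 × Fin 4) := rfl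
      have h1 : (face 2 1 0, face 2 1 1, face 2 1 2) = ((0, 2, 3) : Fin 4 × Fin 4 × Fin 4) := rfl
      have h2 : (face 2 2 0, face 2 2 1, face 2 2 2) = ((0, 1, 3) : Fin 4 × Fin 4 × Fin 4) := rfl
      have h3 : (face 2 3 0, face 2 3 1, face 2 3 2) = ((0, 1, 2) : Fin 4 × Fin 4 × Fin 4) := rfl
      simp only [Prod.mk.injEq] at h0 h1 h2 h3
      obtain ⟨a0, b0, c0⟩ := h0
      obtain ⟨a1, b1, c1⟩ := h1
      obtain ⟨a2, b2, c2⟩ := h2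
      obtain ⟨a3, b3, c3⟩ := h3
      rw [a0, b0, c0, a1, b1, c1, a2, b2, c2, a3, b3, c3]
      have e1 := disp_mul (n := 3) (fun t => s.2 (1 : Fin 4) (2 : Fin 4) (3 : Fin 4) t) 0 1
      have e2 := disp_trans (n := 3) (s.1 (2 : Fin 4) (3 : Fin 4)) 0 1 2
      linarith
    exact_mod_cast h
  · refine Finset.sum_eq_zero fun i _ => ?_
    rw [chernCochain_ne n hn, mul_zero]

/-- The first Chern class `c₁ ∈ H^2(BU(1); ℤ)` of the circle group `U(1)`. -/
def chernU1 : H (BTop Circle) :=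
  H.mk (BTop Circle) ⟨chernCochain, ⟨3, fun n hn => chernCochain_ne n (by omega)⟩, d_chernCochain⟩

/-! ### Chern classes of representations and the Chern ring -/

/-- The inclusion of the diagonal torus `U(1)^n` into `U(n)`. -/
def diagTorus (n : ℕ) : (Fin n → Circle) →ₜ* Matrix.unitaryGroup (Fin n) ℂ where
  toFun z := ⟨Matrix.diagonal fun j => (z j : ℂ), by
    rw [Matrix.mem_unitaryGroup_iff, Matrix.star_eq_conjTranspose, Matrix.diagonal_conjTranspose,
      Matrix.diagonal_mul_diagonal, ← Matrix.diagonal_one]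
    congr 1
    funext j
    simp [Complex.mul_conj]⟩
  map_one' := by
    ext i j
    simp
  map_mul' z w := by
    ext i j
    simp
  continuous_toFun := by
    refine Continuous.subtype_mk ?_ _
    refine Continuous.matrix_diagonal ?_
    fun_prop

/-- The `j`-th coordinate of the torus `U(1)^n`. -/
def torusCoord (n : ℕ) (j : Fin n) : (Fin n → Circle) →ₜ* Circle where
  toFun z := z j
  map_one' := rfl
  map_mul' _ _ := rfl
  continuous_toFun := by fun_prop

/-- The `i`-th elementary symmetric polynomial in the elements `x₁, …, xₙ` of a ring. -/
def elemSymm {R : Type} [Ring R] {n : ℕ} (i : ℕ) (x : Fin n → R) : R :=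
  ∑ s ∈ Finset.powersetCard i Finset.univ, ((s.sort (· ≤ ·)).map x).prod

/-- `c` is the `i`-th universal Chern class, that is, the class `c_i ∈ H^{2i}(BU(n); ℤ)` whose
restriction to the diagonal torus `U(1)^n` is the `i`-th elementary symmetric polynomial in the
first Chern classes `x₁, …, xₙ` of the `n` coordinates. -/
def IsUniversalChernClass (n i : ℕ) (c : H (BTop (Matrix.unitaryGroup (Fin n) ℂ))) : Prop :=
  c ∈ H.degree (BTop (Matrix.unitaryGroup (Fin n) ℂ)) (2 * i) ∧
    H.pull (BTop.map (diagTorus n)) c =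
      elemSymm i fun j : Fin n => H.pull (BTop.map (torusCoord n j)) chernU1

/-- `y` is the `i`-th Chern class `c_i(ρ) = ρ^* c_i` of the unitary representation `ρ` of `G`. -/
def IsChernClass {G : Type} [Group G] {n : ℕ} (ρ : G →* Matrix.unitaryGroup (Fin n) ℂ) (i : ℕ)
    (y : HGrp G) : Prop :=
  ∃ c, IsUniversalChernClass n i c ∧ H.pull (BDisc.toTop ρ) c = y

/-- The Chern ring `Ch(G)`: the subring of `H^*(G; ℤ)` generated by the Chern classes of all
(finite-dimensional, unitary) representations of `G`. -/
def Ch (G : Type) [Group G] : Subring (HGrp G) :=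
  Subring.closure {y | ∃ (n : ℕ) (ρ : G →* Matrix.unitaryGroup (Fin n) ℂ) (i : ℕ),
    IsChernClass ρ i y}

/-- The subring `H^even(G; ℤ)`. -/
abbrev Heven (G : Type) [Group G] : Subring (HGrp G) := H.even (BDisc G)

/-- The first Chern class of a one-dimensional representation. -/
def c₁ {G : Type} [Group G] (θ : G →* Circle) : HGrp G := H.pull (BDisc.toTop θ) chernU1

/-- The nilradical: the two-sided ideal generated by the nilpotent elements. (In a graded-commutative
ring such as `H^*(G; ℤ)` the nilpotent elements already form a two-sided ideal.) -/
def nilrad (R : Type) [Ring R] : TwoSidedIdeal R := TwoSidedIdeal.span {x | IsNilpotent x}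

/-! ### The groups `G(n, ε)` -/

/-- The generators `A`, `B`, `C`. -/
inductive Gen : Type where
  | A | B | C

/-- The commutator `[x, y] = x⁻¹ y⁻¹ x y`. -/
def comm {F : Type} [Group F] (x y : F) : F := x⁻¹ * y⁻¹ * x * y

/-- The relators of `G(n, ε)`, that is, `A^p = B^p = C^(p^(n-2)) = [B, C] = 1`, `[A, C⁻¹] = B`,
`[B, A] = C^(ε p^(n-3))`. -/
def relators (p n : ℕ) (ε : ℤ) : Set (FreeGroup Gen) :=
  let A := FreeGroup.of Gen.A
  let B := FreeGroup.of Gen.B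
  let C := FreeGroup.of Gen.C
  {A ^ p, B ^ p, C ^ (p ^ (n - 2)), comm B C, comm A C⁻¹ * B⁻¹,
    comm B A * (C ^ (ε * (p : ℤ) ^ (n - 3)))⁻¹}

/-- The group `G(n, ε)` (for the prime `p`). -/
abbrev GG (p n : ℕ) (ε : ℤ) : Type := PresentedGroup (relators p n ε)

namespace GG

variable (p n : ℕ) (ε : ℤ)

/-- The generator `B` of `G(n, ε)`. -/
def B : GG p n ε := PresentedGroup.of Gen.B

/-- The generator `C` of `G(n, ε)`. -/
def C : GG p n ε := PresentedGroup.of Gen.C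

/-- The subgroup `M = ⟨B, C⟩`. -/
def M : Subgroup (GG p n ε) := Subgroup.closure {B p n ε, C p n ε}

theorem B_mem : B p n ε ∈ M p n ε := Subgroup.subset_closure (Or.inl rfl)

theorem C_mem : C p n ε ∈ M p n ε := Subgroup.subset_closure (Or.inr rfl)

/-- The subgroup `⟨B⟩`. -/
abbrev cycB : Subgroup (GG p n ε) := Subgroup.zpowers (B p n ε)

theorem cycB_le : cycB p n ε ≤ M p n ε := Subgroup.zpowers_le.mpr (B_mem p n ε)

/-- The restriction `H^*(M; ℤ) → H^*(⟨B⟩; ℤ)`. -/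
def resMB : HGrp (M p n ε) →+* HGrp (cycB p n ε) :=
  HGrp.map (Subgroup.inclusion (cycB_le p n ε))

end GG

end ChernRing

end

open ChernRing

/-!
Write `Z = C^(p^(n-3))`, a central element of order `p`, so that `[B, A] = Z^ε`, and let `β'` be the
generator of `H^2(⟨B⟩; ℤ)`. The Chern ring and the even cohomology ring of `G` are compared after
restriction to `⟨B⟩`.

**The detecting ring.** There is a ring homomorphism `H^*(ℤ/p; ℤ) → 𝔽_p⟦X⟧` with `β' ↦ X`
(`series`, `series_c₁`). Its coefficient of degree `m` is evaluation on the chain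
`∑ [y₀ | 1 | … | y_{m-1} | 1]` of the bar complex, which is a cycle modulo `p`. It is multiplicative
(`evenEval_mul`) because the boundary of that chain is `p` times an integral cycle, on which therefore
every integral cocycle of odd degree vanishes. Since `𝔽_p⟦X⟧` is a domain, this homomorphism kills the
nilradical, and it shows that no power of `β'` is zero.

**The Chern ring misses `β'^(p+1)`.** Conjugate representations have the same Chern classes
(`pull_toTop_conj`, by a prism operator), and the restriction of a representation to `⟨B⟩` can be
diagonalized by a unitary matrix, so its Chern classes become the elementary symmetric polynomials in
the `k_j X`, where the `exp(2πi k_j/p)` are the eigenvalues of `B`. All non-trivial eigenvalues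
have the same multiplicity modulo `p` (`GG.exists_diagonalization`): on an eigenspace of `Z` with
non-trivial eigenvalue, `A` permutes the eigenspaces of `B` transitively, and where `Z` acts trivially,
`B = [A, C⁻¹]` has determinant `1` on each of its own eigenspaces. Hence `∏ (1 + k_j X)` is a product of
powers of `∏_k (1 + k X)`, which involves only powers of `X^(p-1)`, and of the
`(1 + k X)^p = 1 + k X^p`. So the restriction of the Chern ring lies in a subring without terms of degree
`p + 1` (`gapSubring`); this is where `p ≥ 5` is needed.

**The even cohomology ring contains `β'^(p+1)`.** Let `ψ` be the character of `M` with `ψ(B) = 1` and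
`ψ(C) = exp(2πi/p^(n-2))`. Conjugation by `A^i` changes the restriction of `c₁(ψ)` to `⟨B⟩` to
`-ε i β'`, and fixes that of `c₁(θ)`. By the double coset formula, the transfer of
`c₁(ψ)^(p-1) c₁(θ)^2` from `M` to `G` restricts to `∑_i (-ε i)^(p-1) β'^(p+1) = -β'^(p+1)`
(`GG.c₁_pow_mem_map_even`).

**The group.** The order and the `p`-rank are read off from the normal form `A^a B^b C^c`
(`GG.coords_bijective`): the `p`-torsion of `M` is `⟨B, Z⟩`, and an element outside `M` commutes only with
the powers of `Z` in it.
-/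

noncomputable section

namespace ChernRing

section

open CategoryTheory Opposite Simplicial Cochains

/-! ### Functoriality of cohomology -/

section Functoriality

variable {X Y Z : SSet.{0}}

/-- The pull-back of cocycles. -/
def pullCocycle (φ : X ⟶ Y) (z : Cocycles Y) : Cocycles X :=
  ⟨pull φ z.1, z.2.1.pull φ, by rw [d_pull, z.2.2, map_zero]⟩

theorem H.pull_mk (φ : X ⟶ Y) (z : Cocycles Y) :
    H.pull φ (H.mk Y z) = H.mk X (pullCocycle φ z) := rfl

theorem H.mk_surjective (X : SSet.{0}) : Function.Surjective (H.mk X) :=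
  Ideal.Quotient.mk_surjective

/-- Two cocycles whose difference is the coboundary of a bounded cochain have the same class. -/
theorem H.mk_eq_of_d {z w : Cocycles X} (y : Cochains X) (hy : IsBounded y)
    (h : d y = z.1 - w.1) : H.mk X z = H.mk X w :=
  Ideal.Quotient.eq.mpr ⟨y, hy, h⟩

theorem H.pull_pull (φ : X ⟶ Y) (ψ : Y ⟶ Z) (x : H Z) :
    H.pull φ (H.pull ψ x) = H.pull (φ ≫ ψ) x := by
  obtain ⟨z, rfl⟩ := H.mk_surjective Z x
  rfl

theorem H.pull_mem_even (φ : X ⟶ Y) {x : H Y} (hx : x ∈ H.even Y) : H.pull φ x ∈ H.even X := by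
  obtain ⟨z, hz, rfl⟩ := hx
  refine ⟨pullCocycle φ z, fun n hn => ?_, rfl⟩
  funext s
  change z.1 n _ = 0
  rw [hz n hn]
  rfl

theorem H.degree_le_even {k : ℕ} (hk : Even k) {x : H X} (hx : x ∈ H.degree X k) :
    x ∈ H.even X := by
  obtain ⟨z, hz, rfl⟩ := hx
  refine ⟨z, fun n hn => hz n ?_, rfl⟩
  rintro rfl
  exact (Nat.not_even_iff_odd.mpr hn) hk

end Functoriality

theorem HGrp.map_map {G G' G'' : Type} [Group G] [Group G'] [Group G''] (f : G →* G')
    (g : G' →* G'') (x : HGrp G'') : HGrp.map f (HGrp.map g x) = HGrp.map (g.comp f) x :=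
  H.pull_pull _ _ x

theorem HGrp.map_pull_toTop {G G' K : Type} [Group G] [Group G'] [Group K] [TopologicalSpace K]
    (f : G →* G') (ρ : G' →* K) (c : H (BTop K)) :
    HGrp.map f (H.pull (BDisc.toTop ρ) c) = H.pull (BDisc.toTop (ρ.comp f)) c :=
  H.pull_pull _ _ c

/-! ### Invariance under conjugation -/

/-- The alternating double sum in the proof that a prism operator is a homotopy: `D i j` is the value
of a cochain on the `j`-th face of the `i`-th prism simplex. -/
theorem prism_sum (n : ℕ) (D E : ℕ → ℕ → ℤ) (T : ℕ → ℤ) (h0 : ∀ i ≤ n, D i i = T i)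
    (h1 : ∀ i ≤ n, D i (i + 1) = T (i + 1)) (h2 : ∀ i < n, ∀ j ≤ i, D (i + 1) j = E i j)
    (h3 : ∀ i j, i < j → j ≤ n → D i (j + 1) = E i j) :
    ∑ i ∈ Finset.range (n + 1), ∑ j ∈ Finset.range (n + 2), (-1) ^ (i + j) * D i j =
      T 0 - T (n + 1) -
        ∑ i ∈ Finset.range n, ∑ j ∈ Finset.range (n + 1), (-1) ^ (i + j) * E i j := by
  have row : ∀ i ∈ Finset.range (n + 1),
      ∑ j ∈ Finset.range (n + 2), (-1) ^ (i + j) * D i j =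
        ∑ j ∈ Finset.range i, (-1) ^ (i + j) * D i j + (T i - T (i + 1)) -
          ∑ j ∈ Finset.Ico (i + 1) (n + 1), (-1) ^ (i + j) * E i j := by
    intro i hi
    have hi' : i ≤ n := by simpa [Nat.lt_succ_iff] using hi
    rw [← Finset.sum_range_add_sum_Ico _ (by omega : i ≤ n + 2),
      Finset.sum_eq_sum_Ico_succ_bot (by omega : i < n + 2),
      Finset.sum_eq_sum_Ico_succ_bot (by omega : i + 1 < n + 2),
      h0 i hi', h1 i hi', ← Finset.sum_Ico_add' _ (i + 1) (n + 1) 1, ← add_assoc i i 1, pow_succ,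
      Even.neg_one_pow ⟨i, rfl⟩]
    have : ∀ j ∈ Finset.Ico (i + 1) (n + 1), (-1 : ℤ) ^ (i + (j + 1)) * D i (j + 1) =
        -((-1) ^ (i + j) * E i j) := by
      intro j hj
      rw [Finset.mem_Ico] at hj
      rw [h3 i j (by omega) (by omega)]
      ring
    rw [Finset.sum_congr rfl this, Finset.sum_neg_distrib]
    ring
  rw [Finset.sum_congr rfl row, Finset.sum_sub_distrib, Finset.sum_add_distrib,
    Finset.sum_range_sub', Finset.sum_range_succ', Finset.sum_range_succ _ n, Finset.Ico_self]
  have h4 : ∀ i ∈ Finset.range n, ∑ j ∈ Finset.range (i + 1), (-1) ^ (i + 1 + j) * D (i + 1) j =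
      ∑ j ∈ Finset.Ico (i + 1) (n + 1), (-1) ^ (i + j) * E i j -
        ∑ j ∈ Finset.range (n + 1), (-1) ^ (i + j) * E i j := by
    intro i hi
    rw [Finset.mem_range] at hi
    have : ∀ j ∈ Finset.range (i + 1), (-1) ^ (i + 1 + j) * D (i + 1) j =
        -((-1) ^ (i + j) * E i j) := by
      intro j hj
      rw [Finset.mem_range] at hj
      rw [h2 i hi j (by omega)]
      ring
    rw [Finset.sum_congr rfl this, Finset.sum_neg_distrib,
      ← Finset.sum_range_add_sum_Ico _ (by omega : i + 1 ≤ n + 1)]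
    ring
  rw [Finset.sum_congr rfl h4, Finset.sum_sub_distrib]
  simp only [Finset.range_zero, Finset.sum_empty]
  ring

section Conjugation

variable {G K : Type} [Group G] [Group K] [TopologicalSpace K]

/-- The simplex of `BK` with constant entries `(u x)⁻¹ * ρ (s (σ x) (σ y)) * u y`: the pull-back
of `s` along `σ`, pushed forward by `ρ` and gauge transformed by `u`. -/
def gauge (ρ : G →* K) {m n : ℕ} (σ : Fin (m + 1) → Fin (n + 1)) (u : Fin (m + 1) → K)
    (s : (BDisc G) _⦋n⦌) : (BTop K) _⦋m⦌ :=
  ⟨fun x y => ContinuousMap.const _ ((u x)⁻¹ * ρ (s.1 (σ x) (σ y)) * u y), fun i j k t => by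
    change (u i)⁻¹ * ρ (s.1 (σ i) (σ j)) * u j * ((u j)⁻¹ * ρ (s.1 (σ j) (σ k)) * u k) =
      (u i)⁻¹ * ρ (s.1 (σ i) (σ k)) * u k
    rw [← s.2 (σ i) (σ j) (σ k), map_mul]
    group⟩

theorem act_gauge (ρ : G →* K) {l m n : ℕ} (f : Fin (l + 1) →o Fin (m + 1))
    (σ : Fin (m + 1) → Fin (n + 1)) (u : Fin (m + 1) → K) (s : (BDisc G) _⦋n⦌) :
    act (BTop K) f (gauge ρ σ u s) = gauge ρ (σ ∘ f) (u ∘ f) s := rfl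

theorem gauge_act (ρ : G →* K) {l m n : ℕ} (f : Fin (l + 1) →o Fin (n + 1))
    (σ : Fin (m + 1) → Fin (l + 1)) (u : Fin (m + 1) → K) (s : (BDisc G) _⦋n⦌) :
    gauge ρ σ u (act (BDisc G) f s) = gauge ρ (f ∘ σ) u s := rfl

/-- The `i`-th degeneracy `[n + 1] → [n]`. -/
def degen (n i : ℕ) (x : Fin (n + 2)) : Fin (n + 1) :=
  ⟨if x.1 ≤ i then min x.1 n else x.1 - 1, by split_ifs <;> omega⟩

/-- The gauge transformation that is `1` at the vertices before `i` and `t` from `i` on. -/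
def stepGauge (t : K) (m i : ℕ) (x : Fin (m + 1)) : K := if x.1 < i then 1 else t

/-- The prism operator of the homotopy between `ρ` and its conjugate by `t`. -/
def prism (ρ : G →* K) (t : K) (f : Cochains (BTop K)) : Cochains (BDisc G) where
  toFun n s := ∑ i ∈ Finset.range (n + 1),
    (-1) ^ i * f (n + 1) (gauge ρ (degen n i) (stepGauge t (n + 1) (i + 1)) s)

theorem gauge_face_congr (ρ : G →* K) {m n : ℕ} {σ τ : Fin (m + 1) → Fin (n + 1)}
    {u v : Fin (m + 1) → K} (h : ∀ x, σ x = τ x ∧ u x = v x) (s : (BDisc G) _⦋n⦌) :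
    gauge ρ σ u s = gauge ρ τ v s := by
  rw [show σ = τ from funext fun x => (h x).1, show u = v from funext fun x => (h x).2]

theorem d_prism (ρ : G →* K) (t : K) (f : Cochains (BTop K)) (n : ℕ) (s : (BDisc G) _⦋n⦌) :
    prism ρ t (d f) n s + d (prism ρ t f) n s =
      f n (gauge ρ id (stepGauge t n 0) s) - f n (gauge ρ id (stepGauge t n (n + 1)) s) := by
  have hD : prism ρ t (d f) n s = ∑ i ∈ Finset.range (n + 1), ∑ j ∈ Finset.range (n + 2),
      (-1) ^ (i + j) * f n (gauge ρ (degen n i ∘ face n j)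
        (stepGauge t (n + 1) (i + 1) ∘ face n j) s) := by
    change ∑ i ∈ Finset.range (n + 1), (-1) ^ i * ∑ j ∈ Finset.range (n + 2), _ = _
    simp only [Finset.mul_sum, act_gauge, pow_add, mul_assoc]
  cases n with
  | zero =>
    rw [hD, d_zero_apply]
    simp only [Finset.sum_range_succ, Finset.sum_range_zero]
    rw [gauge_face_congr ρ (σ := degen 0 0 ∘ face 0 0) (τ := id) (v := stepGauge t 0 0) ?_ s,
      gauge_face_congr ρ (σ := degen 0 0 ∘ face 0 1) (τ := id) (v := stepGauge t 0 1) ?_ s]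
    · ring
    all_goals
      intro x
      simp only [Function.comp, stepGauge, face_val, Fin.ext_iff, degen, id]
      constructor <;> grind
  | succ n =>
    have hE : d (prism ρ t f) (n + 1) s =
        ∑ i ∈ Finset.range (n + 1), ∑ j ∈ Finset.range (n + 2), (-1) ^ (i + j) *
          f (n + 1) (gauge ρ (face n j ∘ degen n i) (stepGauge t (n + 1) (i + 1)) s) := by
      rw [Finset.sum_comm, d_succ_apply]
      refine Finset.sum_congr rfl fun j _ => ?_
      change _ * ∑ i ∈ Finset.range (n + 1), _ = _
      simp only [Finset.mul_sum, gauge_act, pow_add]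
      refine Finset.sum_congr rfl fun i _ => by ring
    rw [hD, hE, prism_sum (n + 1)
      (fun i j => f (n + 1) (gauge ρ (degen (n + 1) i ∘ face (n + 1) j)
        (stepGauge t (n + 2) (i + 1) ∘ face (n + 1) j) s))
      (fun i j => f (n + 1) (gauge ρ (face n j ∘ degen n i) (stepGauge t (n + 1) (i + 1)) s))
      (fun i => f (n + 1) (gauge ρ id (stepGauge t (n + 1) i) s))]
    · ring
    · intro i hi
      congr 1
      refine gauge_face_congr ρ (fun x => ?_) s
      simp only [Function.comp, stepGauge, face_val, Fin.ext_iff, degen, id]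
      constructor <;> grind
    · intro i hi
      congr 1
      refine gauge_face_congr ρ (fun x => ?_) s
      simp only [Function.comp, stepGauge, face_val, Fin.ext_iff, degen, id]
      constructor <;> grind
    · intro i hi j hj
      congr 1
      refine gauge_face_congr ρ (fun x => ?_) s
      simp only [Function.comp, stepGauge, face_val, Fin.ext_iff, degen]
      constructor <;> grind
    · intro i j hij hj
      congr 1
      refine gauge_face_congr ρ (fun x => ?_) s
      simp only [Function.comp, stepGauge, face_val, Fin.ext_iff, degen]
      constructor <;> grind

/-- Conjugate homomorphisms induce the same map in cohomology. -/
theorem pull_toTop_conj (ρ ρ' : G →* K) (t : K) (h : ∀ g, ρ' g = t⁻¹ * ρ g * t)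
    (c : H (BTop K)) : H.pull (BDisc.toTop ρ') c = H.pull (BDisc.toTop ρ) c := by
  obtain ⟨z, rfl⟩ := H.mk_surjective _ c
  rw [H.pull_mk, H.pull_mk]
  refine H.mk_eq_of_d (prism ρ t z.1) ?_ ?_
  · obtain ⟨N, hN⟩ := z.2.1
    refine ⟨N, fun n hn => funext fun s => ?_⟩
    change ∑ i ∈ Finset.range (n + 1), _ * z.1 (n + 1) _ = 0
    rw [hN (n + 1) (by omega)]
    simp
  · ext n s
    have key := d_prism ρ t z.1 n s
    have h0 : prism ρ t (d z.1) n s = 0 := by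
      rw [z.2.2]
      change ∑ i ∈ Finset.range (n + 1), _ * (0 : ℤ) = 0
      simp
    rw [h0, zero_add] at key
    rw [key, sub_eq_add_neg, sub_eq_add_neg, add_apply, neg_apply]
    change _ = z.1 n ((BDisc.toTop ρ').app (op ⦋n⦌) s) + -z.1 n ((BDisc.toTop ρ).app (op ⦋n⦌) s)
    congr 3
    · refine Subtype.ext (funext fun x => funext fun y => ?_)
      change ContinuousMap.const _ (t⁻¹ * ρ (s.1 x y) * t) = ContinuousMap.const _ (ρ' (s.1 x y))
      rw [h]
    · refine Subtype.ext (funext fun x => funext fun y => ?_)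
      change ContinuousMap.const _ ((stepGauge t n (n + 1) x)⁻¹ * ρ (s.1 x y) *
        stepGauge t n (n + 1) y) = ContinuousMap.const _ (ρ (s.1 x y))
      rw [stepGauge, stepGauge, if_pos x.2, if_pos y.2]
      simp

end Conjugation

/-! ### First Chern classes of characters -/

section FirstChern

variable {G G' : Type} [Group G] [Group G']

theorem HGrp.map_c₁ (f : G →* G') (θ : G' →* Circle) : HGrp.map f (c₁ θ) = c₁ (θ.comp f) :=
  HGrp.map_pull_toTop f θ chernU1

/-- The cocycle that represents `c₁ θ`. -/
def chernCocycle (θ : G →* Circle) : Cocycles (BDisc G) :=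
  pullCocycle (BDisc.toTop θ)
    ⟨chernCochain, ⟨3, fun n hn => chernCochain_ne n (by omega)⟩, d_chernCochain⟩

theorem mk_chernCocycle (θ : G →* Circle) : H.mk _ (chernCocycle θ) = c₁ θ := rfl

theorem chernCocycle_ne (θ : G →* Circle) (n : ℕ) (hn : n ≠ 2) (s : (BDisc G) _⦋n⦌) :
    (chernCocycle θ).1 n s = 0 := by
  change chernCochain n _ = 0
  rw [chernCochain_ne n hn]

theorem disp_const {n : ℕ} (z : Circle) (i j : Fin (n + 1)) :
    disp (ContinuousMap.const (Simplex n) z) i j = 0 := by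
  rw [disp_eq (σ := ContinuousMap.const (Simplex n) z) (ContinuousMap.const _ (angle z))
    fun t => exp_angle z]
  simp

theorem chernCocycle_two (θ : G →* Circle) (s : (BDisc G) _⦋2⦌) :
    ((chernCocycle θ).1 2 s : ℝ) = angle (θ (s.1 (0 : Fin 3) (1 : Fin 3))) +
      angle (θ (s.1 (1 : Fin 3) (2 : Fin 3))) - angle (θ (s.1 (0 : Fin 3) (2 : Fin 3))) := by
  refine (chernCochain_two ((BDisc.toTop θ).app (op ⦋2⦌) s)).trans ?_
  have h : disp (n := 2) (((BDisc.toTop θ).app (op ⦋2⦌) s).1 (1 : Fin 3) (2 : Fin 3)) 0 1 = 0 :=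
    disp_const (n := 2) (θ (s.1 (1 : Fin 3) (2 : Fin 3))) 0 1
  rw [turn, h, sub_zero]
  rfl

theorem exists_int_angle (z w : Circle) : ∃ m : ℤ, angle z + angle w - angle (z * w) = m := by
  have h : Circle.exp (2 * Real.pi * (angle z + angle w - angle (z * w))) = 1 := by
    rw [mul_sub, mul_add, Circle.exp_sub, Circle.exp_add, exp_angle, exp_angle, exp_angle, div_self']
  obtain ⟨m, hm⟩ := Circle.exp_eq_one.mp h
  refine ⟨m, mul_left_cancel₀ (by positivity : (2 * Real.pi) ≠ 0) ?_⟩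
  rw [hm, mul_comm]

/-- The integral `1`-cochain `angle θ + angle ψ - angle (θ ψ)`. -/
def angleDefect (θ ψ : G →* Circle) : Cochains (BDisc G) where
  toFun n := match n with
    | 1 => fun s => ⌊angle (θ (s.1 (0 : Fin 2) (1 : Fin 2))) +
        angle (ψ (s.1 (0 : Fin 2) (1 : Fin 2))) -
        angle (θ (s.1 (0 : Fin 2) (1 : Fin 2)) * ψ (s.1 (0 : Fin 2) (1 : Fin 2)))⌋
    | _ => fun _ => 0

theorem angleDefect_one (θ ψ : G →* Circle) (s : (BDisc G) _⦋1⦌) :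
    (angleDefect θ ψ 1 s : ℝ) = angle (θ (s.1 (0 : Fin 2) (1 : Fin 2))) +
        angle (ψ (s.1 (0 : Fin 2) (1 : Fin 2))) -
        angle (θ (s.1 (0 : Fin 2) (1 : Fin 2)) * ψ (s.1 (0 : Fin 2) (1 : Fin 2))) := by
  obtain ⟨m, hm⟩ := exists_int_angle (θ (s.1 (0 : Fin 2) (1 : Fin 2)))
    (ψ (s.1 (0 : Fin 2) (1 : Fin 2)))
  change ((⌊_⌋ : ℤ) : ℝ) = _
  rw [hm, Int.floor_intCast]

theorem angleDefect_ne (θ ψ : G →* Circle) (n : ℕ) (hn : n ≠ 1) :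
    angleDefect θ ψ n = fun _ => 0 := by
  match n, hn with
  | 0, _ => rfl
  | n + 2, _ => rfl

theorem c₁_mul (θ ψ : G →* Circle) : c₁ (θ * ψ) = c₁ θ + c₁ ψ := by
  symm
  rw [← mk_chernCocycle, ← mk_chernCocycle, ← mk_chernCocycle, ← map_add]
  refine H.mk_eq_of_d (angleDefect θ ψ)
    ⟨2, fun n hn => angleDefect_ne θ ψ n (by omega)⟩ ?_
  ext n s
  change _ = (chernCocycle θ).1 n s + (chernCocycle ψ).1 n s + -(chernCocycle (θ * ψ)).1 n s
  by_cases hn : n = 2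
  · subst hn
    rw [d_succ_apply]
    have h : ((∑ i ∈ Finset.range 3, (-1) ^ i *
        angleDefect θ ψ 1 (act (BDisc G) (face 1 i) s) : ℤ) : ℝ) =
        (((chernCocycle θ).1 2 s + (chernCocycle ψ).1 2 s +
          -(chernCocycle (θ * ψ)).1 2 s : ℤ) : ℝ) := by
      push_cast
      simp only [Finset.sum_range_succ, Finset.sum_range_zero, angleDefect_one, chernCocycle_two]
      have e0 : (act (BDisc G) (face 1 0) s).1 (0 : Fin 2) (1 : Fin 2) =
        s.1 (1 : Fin 3) (2 : Fin 3) := rfl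
      have e1 : (act (BDisc G) (face 1 1) s).1 (0 : Fin 2) (1 : Fin 2) =
        s.1 (0 : Fin 3) (2 : Fin 3) := rfl
      have e2 : (act (BDisc G) (face 1 2) s).1 (0 : Fin 2) (1 : Fin 2) =
        s.1 (0 : Fin 3) (1 : Fin 3) := rfl
      rw [e0, e1, e2]
      simp only [MonoidHom.mul_apply]
      ring
    exact_mod_cast h
  · rw [chernCocycle_ne _ n hn, chernCocycle_ne _ n hn, chernCocycle_ne _ n hn]
    rcases n with _ | n
    · rfl
    · rw [d_succ_apply, angleDefect_ne θ ψ n (by omega)]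
      simp

theorem c₁_zpow (θ : G →* Circle) (k : ℤ) : c₁ (θ ^ k) = k • c₁ θ := by
  have h1 : c₁ (1 : G →* Circle) = 0 := by
    have h := c₁_mul (1 : G →* Circle) 1
    rwa [one_mul, right_eq_add] at h
  let F : (G →* Circle) →* Multiplicative (HGrp G) :=
    { toFun := fun χ => Multiplicative.ofAdd (c₁ χ)
      map_one' := by rw [h1]; rfl
      map_mul' := fun χ η => by rw [c₁_mul]; rfl }
  exact congrArg Multiplicative.toAdd (map_zpow F θ k)

theorem c₁_mem_even (θ : G →* Circle) : c₁ θ ∈ Heven G := by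
  refine ⟨chernCocycle θ, fun n hn => funext fun s => chernCocycle_ne θ n ?_ s, rfl⟩
  rintro rfl
  exact (by decide : ¬ Odd 2) hn

end FirstChern

/-! ### Chern classes of diagonalized representations -/

theorem Ch_le_Heven (G : Type) [Group G] : Ch G ≤ Heven G := by
  refine Subring.closure_le.mpr ?_
  rintro y ⟨n, ρ, i, c, hc, rfl⟩
  exact H.pull_mem_even _ (H.degree_le_even (even_two_mul i) hc.1)

theorem map_elemSymm {R S : Type} [Ring R] [Ring S] (f : R →+* S) {n : ℕ} (i : ℕ) (x : Fin n → R) :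
    f (elemSymm i x) = elemSymm i (f ∘ x) := by
  simp only [elemSymm, map_sum, map_list_prod, List.map_map]

theorem elemSymm_eq {R : Type} [CommRing R] {n : ℕ} (i : ℕ) (x : Fin n → R) :
    elemSymm i x = ∑ s ∈ Finset.powersetCard i Finset.univ, ∏ j ∈ s, x j := by
  refine Finset.sum_congr rfl fun s _ => ?_
  rw [← Multiset.prod_coe, ← Multiset.map_coe, Finset.sort_eq]
  rfl

/-- If the restriction of `ρ` along `f` is conjugate to the sum of the characters `χ j`, then the
restriction of `c_i(ρ)` is the `i`-th elementary symmetric polynomial in the `c₁ (χ j)`. -/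
theorem map_chernClass_of_diagonal {G G' : Type} [Group G] [Group G'] (f : G' →* G) {n : ℕ}
    (ρ : G →* Matrix.unitaryGroup (Fin n) ℂ) (t : Matrix.unitaryGroup (Fin n) ℂ)
    (χ : Fin n → G' →* Circle)
    (h : ∀ g, (diagTorus n fun j => χ j g) = t⁻¹ * ρ (f g) * t) {i : ℕ} {y : HGrp G}
    (hy : IsChernClass ρ i y) : HGrp.map f y = elemSymm i fun j => c₁ (χ j) := by
  obtain ⟨c, hc, rfl⟩ := hy
  let δ : G' →* (Fin n → Circle) := MonoidHom.pi χ
  have e : H.pull (BDisc.toTop (ρ.comp f)) c =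
      H.pull (BDisc.toTop δ) (H.pull (BTop.map (diagTorus n)) c) := by
    rw [← pull_toTop_conj (ρ.comp f) (MonoidHom.comp (diagTorus n : _ →* _) δ) t h c,
      H.pull_pull]
    rfl
  rw [HGrp.map_pull_toTop, e, hc.2, map_elemSymm]
  congr 1

/-! ### The cohomology of a cyclic group of prime order modulo nilpotents -/

section Cyclic

variable {p : ℕ}

/-- The simplex of the classifying space of `ℤ/p` with vertices `v 0, v 1, …, v n`. -/
def vertexSimplex (n : ℕ) (v : ℕ → ZMod p) : (BDisc (Multiplicative (ZMod p))) _⦋n⦌ :=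
  ⟨fun i j => Multiplicative.ofAdd (v j.1 - v i.1), fun i j k => by
    rw [← ofAdd_add, add_comm, sub_add_sub_cancel]⟩

theorem act_vertexSimplex {m n : ℕ} (f : Fin (m + 1) →o Fin (n + 1)) {v w : ℕ → ZMod p}
    (c : ZMod p) (h : ∀ i : Fin (m + 1), v (f i).1 = w i.1 + c) :
    act _ f (vertexSimplex n v) = vertexSimplex m w := by
  refine Subtype.ext (funext fun i => funext fun j => ?_)
  change Multiplicative.ofAdd (v (f j).1 - v (f i).1) = Multiplicative.ofAdd (w j.1 - w i.1)
  rw [h, h, add_sub_add_right_eq_sub]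

/-- The simplex `[e 0 | e 1 | … | e (n - 1)]` in bar notation. -/
def barSimplex (n : ℕ) (e : ℕ → ZMod p) : (BDisc (Multiplicative (ZMod p))) _⦋n⦌ :=
  vertexSimplex n fun i => ∑ l ∈ Finset.range i, e l

theorem barSimplex_congr {n : ℕ} {e e' : ℕ → ZMod p} (h : ∀ i < n, e i = e' i) :
    barSimplex n e = barSimplex n e' := by
  rw [← act_id (BDisc _) (barSimplex n e)]
  refine act_vertexSimplex _ 0 fun i => ?_
  rw [add_zero]
  refine Finset.sum_congr rfl fun l hl => h l ?_
  have := Finset.mem_range.mp hl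
  have h' : (OrderHom.id i).1 < n + 1 := (OrderHom.id i).2
  omega

theorem front_barSimplex {a n : ℕ} (h : a ≤ n) (e : ℕ → ZMod p) :
    act _ (front a n) (barSimplex n e) = barSimplex a e := by
  refine act_vertexSimplex _ 0 fun i => ?_
  rw [front_val, min_eq_left (by omega), add_zero]

theorem back_barSimplex {a b n : ℕ} (h : a + b = n) (e : ℕ → ZMod p) :
    act _ (back b n) (barSimplex n e) = barSimplex b fun i => e (a + i) := by
  subst h
  refine act_vertexSimplex _ (∑ l ∈ Finset.range a, e l) fun i => ?_
  rw [back_val, Nat.add_sub_cancel, min_eq_left (by omega), Finset.sum_range_add, add_comm]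

theorem face_zero_barSimplex (n : ℕ) (e : ℕ → ZMod p) :
    act _ (face n 0) (barSimplex (n + 1) e) = barSimplex n fun i => e (i + 1) := by
  refine act_vertexSimplex _ (e 0) fun i => ?_
  rw [face_val, if_neg (by omega), Finset.sum_range_succ']

/-- The extension by zero of a finite sequence. -/
def extend {m : ℕ} (y : Fin m → ZMod p) (i : ℕ) : ZMod p := if h : i < m then y ⟨i, h⟩ else 0

/-- The sequence `x 0, 1, x 1, 1, …`. -/
def evenEdges (x : ℕ → ZMod p) (l : ℕ) : ZMod p := if l % 2 = 0 then x (l / 2) else 1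

/-- The sequence `1, x 0, 1, x 1, …`. -/
def oddEdges (x : ℕ → ZMod p) (l : ℕ) : ZMod p := if l % 2 = 0 then 1 else x (l / 2)

variable [NeZero p]

/-- The value of a cochain on the chain `∑ [y₀ | 1 | y₁ | 1 | … | y_{m-1} | 1]` of degree `2 m`. It
is a cycle modulo `p`, and represents a generator of `H_{2m}(ℤ/p; 𝔽_p)`. -/
def evenEval (m : ℕ) (f : Cochains (BDisc (Multiplicative (ZMod p)))) : ℤ :=
  ∑ y : Fin m → ZMod p, f (2 * m) (barSimplex (2 * m) (evenEdges (extend y)))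

/-- The value of a cochain on the cycle `∑ [1 | y₀ | 1 | y₁ | … | y_{m-1} | 1]` of degree
`2 m + 1`. -/
def oddEval (m : ℕ) (f : Cochains (BDisc (Multiplicative (ZMod p)))) : ℤ :=
  ∑ y : Fin m → ZMod p, f (2 * m + 1) (barSimplex (2 * m + 1) (oddEdges (extend y)))

theorem sum_alternating_pairs (N : ℕ) (b : ℕ → ℤ) (h : ∀ k < N, b (2 * k) = b (2 * k + 1)) :
    ∑ i ∈ Finset.range (2 * N), (-1) ^ (i + 1) * b i = 0 := by
  induction N with
  | zero => simp
  | succ N ih =>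
    rw [mul_add, mul_one, Finset.sum_range_succ, Finset.sum_range_succ,
      ih fun k hk => h k (by omega), h N (by omega)]
    ring

theorem sum_face_odd_eq (m k : ℕ) (f : Cochains (BDisc (Multiplicative (ZMod p)))) :
    ∑ y : Fin (m + 1) → ZMod p, f (2 * m + 1) (act _ (face (2 * m + 1) (2 * k + 1))
        (barSimplex (2 * m + 1 + 1) (evenEdges (extend y)))) =
      ∑ y : Fin (m + 1) → ZMod p, f (2 * m + 1) (act _ (face (2 * m + 1) (2 * k + 1 + 1))
        (barSimplex (2 * m + 1 + 1) (evenEdges (extend y)))) := by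
  let δ : Fin (m + 1) → ZMod p := fun i => if i.1 = k then 1 else if i.1 = k + 1 then -1 else 0
  refine Fintype.sum_equiv (Equiv.addRight δ) _ _ fun y => ?_
  have he : ∀ l < 2 * m + 2, evenEdges (extend (y + δ)) l = evenEdges (extend y) l +
      if l = 2 * k then 1 else if l = 2 * k + 2 then -1 else 0 := by
    intro l hl
    by_cases h2 : l % 2 = 0
    · simp only [evenEdges, h2, if_true, extend, dif_pos (show l / 2 < m + 1 by omega),
        Pi.add_apply, δ]
      have e1 : (l / 2 = k) = (l = 2 * k) := by apply propext; omega
      have e2 : (l / 2 = k + 1) = (l = 2 * k + 2) := by apply propext; omega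
      simp only [e1, e2]
    · rw [if_neg (by omega), if_neg (by omega)]
      simp [evenEdges, h2]
  have hV : ∀ i ≤ 2 * m + 2, ∑ l ∈ Finset.range i, evenEdges (extend (y + δ)) l =
      ∑ l ∈ Finset.range i, evenEdges (extend y) l +
        if i = 2 * k + 1 ∨ i = 2 * k + 2 then 1 else 0 := by
    intro i
    induction i with
    | zero => intro _; simp
    | succ i ih =>
      intro hi
      rw [Finset.sum_range_succ, Finset.sum_range_succ, ih (by omega), he i (by omega)]
      have : (if i = 2 * k + 1 ∨ i = 2 * k + 2 then (1 : ZMod p) else 0) +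
          (if i = 2 * k then 1 else if i = 2 * k + 2 then -1 else 0) =
          if i + 1 = 2 * k + 1 ∨ i + 1 = 2 * k + 2 then 1 else 0 := by
        split_ifs <;> first | omega | simp
      rw [← this]
      ring
  congr 1
  refine (act_vertexSimplex _ 0 (w := fun i => ∑ l ∈ Finset.range
    (face (2 * m + 1) (2 * k + 1) (Fin.ofNat _ i)).1, evenEdges (extend y) l) fun i => ?_).trans
    (act_vertexSimplex _ 0 fun i => ?_).symm
  · rw [add_zero, Fin.ofNat_eq_cast, Fin.cast_val_eq_self]
  · rw [Fin.ofNat_eq_cast, Fin.cast_val_eq_self, add_zero, Equiv.coe_addRight, hV _ (by omega)]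
    generalize hu : (face (2 * m + 1) (2 * k + 1 + 1) i).1 = u
    generalize hw : (face (2 * m + 1) (2 * k + 1) i).1 = w
    rw [face_val] at hu hw
    rcases lt_trichotomy i.1 (2 * k + 1) with h | h | h
    · rw [if_pos (by omega)] at hu hw
      rw [← hu, ← hw, if_neg (by omega), add_zero]
    · rw [if_pos (by omega)] at hu
      rw [if_neg (by omega)] at hw
      rw [← hu, ← hw, if_pos (by omega), Finset.sum_range_succ, evenEdges, if_neg (by omega)]
    · rw [if_neg (by omega)] at hu hw
      rw [← hu, ← hw, if_neg (by omega), add_zero]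

/-- The boundary of the even chain is `p` times the odd cycle. -/
theorem evenEval_d (m : ℕ) (f : Cochains (BDisc (Multiplicative (ZMod p)))) :
    evenEval (m + 1) (d f) = p * oddEval m f := by
  have h1 : evenEval (m + 1) (d f) = ∑ i ∈ Finset.range (2 * m + 3), (-1) ^ i *
      ∑ y : Fin (m + 1) → ZMod p, f (2 * m + 1) (act _ (face (2 * m + 1) i)
        (barSimplex (2 * m + 1 + 1) (evenEdges (extend y)))) := by
    simp only [Finset.mul_sum]
    rw [Finset.sum_comm]
    rfl
  have h0 := sum_alternating_pairs (m + 1) (fun i => ∑ y : Fin (m + 1) → ZMod p, f (2 * m + 1)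
      (act _ (face (2 * m + 1) (i + 1)) (barSimplex (2 * m + 1 + 1) (evenEdges (extend y)))))
      fun k _ => sum_face_odd_eq m k f
  rw [show 2 * (m + 1) = 2 * m + 2 by ring] at h0
  rw [h1, Finset.sum_range_succ', h0, zero_add, pow_zero, one_mul]
  have h2 : ∀ (a : ZMod p) (y : Fin m → ZMod p), act _ (face (2 * m + 1) 0)
      (barSimplex (2 * m + 1 + 1) (evenEdges (extend (Fin.cons a y : Fin (m + 1) → ZMod p)))) =
      barSimplex (2 * m + 1) (oddEdges (extend y)) := by
    intro a y
    rw [face_zero_barSimplex]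
    refine barSimplex_congr fun i hi => ?_
    rcases Nat.even_or_odd' i with ⟨j, rfl | rfl⟩
    · rw [evenEdges, oddEdges, if_neg (by omega), if_pos (by omega)]
    · rw [evenEdges, oddEdges, if_pos (by omega), if_neg (by omega),
        show (2 * j + 1 + 1) / 2 = j + 1 by omega, show (2 * j + 1) / 2 = j by omega,
        extend, extend, dif_pos (by omega), dif_pos (by omega)]
      exact Fin.cons_succ (α := fun _ => ZMod p) a y ⟨j, by omega⟩
  rw [← (Fin.consEquiv fun _ : Fin (m + 1) => ZMod p).sum_comp, Fintype.sum_prod_type]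
  refine (Finset.sum_congr rfl fun a _ => Finset.sum_congr rfl fun y _ =>
    congrArg (f (2 * m + 1)) (h2 a y)).trans ?_
  rw [Finset.sum_const, Finset.card_univ, ZMod.card, nsmul_eq_mul]
  rfl

theorem oddEval_eq_zero (m : ℕ) {f : Cochains (BDisc (Multiplicative (ZMod p)))} (hf : d f = 0) :
    oddEval m f = 0 := by
  have h := evenEval_d m f
  rw [hf] at h
  have h0 : evenEval (m + 1) (0 : Cochains (BDisc (Multiplicative (ZMod p)))) = 0 :=
    Finset.sum_eq_zero fun _ _ => rfl
  rw [h0, eq_comm, mul_eq_zero] at h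
  exact h.resolve_left (by exact_mod_cast NeZero.ne p)

theorem sum_extend_split (k l : ℕ) (F F' : (ℕ → ZMod p) → ℤ)
    (hF : ∀ x x' : ℕ → ZMod p, (∀ i < k, x i = x' i) → F x = F x') :
    ∑ y : Fin (k + l) → ZMod p, F (extend y) * F' (fun i => extend y (k + i)) =
      (∑ y : Fin k → ZMod p, F (extend y)) * ∑ y : Fin l → ZMod p, F' (extend y) := by
  rw [← (Fin.appendEquiv k l).sum_comp, Fintype.sum_prod_type, Finset.sum_mul_sum]
  refine Finset.sum_congr rfl fun y _ => Finset.sum_congr rfl fun z _ => ?_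
  congr 1
  · refine hF _ _ fun i hi => ?_
    rw [extend, extend, dif_pos (by omega), dif_pos hi]
    exact Fin.append_left y z ⟨i, hi⟩
  · congr 1
    funext i
    by_cases hi : i < l
    · rw [extend, extend, dif_pos (by omega), dif_pos hi]
      exact Fin.append_right y z ⟨i, hi⟩
    · rw [extend, extend, dif_neg (by omega), dif_neg hi]

/-- Evaluation on the even chains turns cup products of cocycles into products: the terms of odd
bidegree vanish because an integral cocycle vanishes on the odd cycles. -/
theorem evenEval_mul (m : ℕ) (f g : Cochains (BDisc (Multiplicative (ZMod p)))) (hg : d g = 0) :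
    evenEval m (f * g) =
      ∑ x ∈ Finset.HasAntidiagonal.antidiagonal m, evenEval x.1 f * evenEval x.2 g := by
  have h1 : evenEval m (f * g) = ∑ x ∈ Finset.HasAntidiagonal.antidiagonal (2 * m),
      ∑ y : Fin m → ZMod p, f x.1 (act _ (front x.1 (2 * m))
          (barSimplex (2 * m) (evenEdges (extend y)))) *
        g x.2 (act _ (back x.2 (2 * m)) (barSimplex (2 * m) (evenEdges (extend y)))) := by
    rw [Finset.sum_comm]
    rfl
  rw [h1]
  symm
  refine Finset.sum_of_injOn (fun x => (2 * x.1, 2 * x.2)) ?_ ?_ ?_ ?_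
  · rintro ⟨a, b⟩ _ ⟨a', b'⟩ _ h
    simp only [Prod.mk.injEq] at h ⊢
    omega
  · rintro ⟨a, b⟩ h
    simp only [Finset.mem_coe, Finset.HasAntidiagonal.mem_antidiagonal] at h ⊢
    omega
  · rintro ⟨a, b⟩ h h'
    rw [Finset.HasAntidiagonal.mem_antidiagonal] at h
    rcases Nat.even_or_odd' a with ⟨k, rfl | rfl⟩
    · refine absurd ⟨(k, m - k), ?_, ?_⟩ h'
      · simp only [Finset.mem_coe, Finset.HasAntidiagonal.mem_antidiagonal]
        omega
      · simp only [Prod.mk.injEq, true_and]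
        omega
    · obtain ⟨l, rfl⟩ : ∃ l, b = 2 * l + 1 := ⟨b / 2, by omega⟩
      obtain rfl : m = (k + 1) + l := by omega
      have h2 := sum_extend_split (k + 1) l
        (fun x => f (2 * k + 1) (barSimplex (2 * k + 1) (evenEdges x)))
        (fun x => g (2 * l + 1) (barSimplex (2 * l + 1) (oddEdges x)))
        (fun x x' hx => by
          rw [barSimplex_congr fun i hi => ?_]
          simp only [evenEdges, hx (i / 2) (by omega)])
      have h3 := oddEval_eq_zero l hg
      rw [oddEval] at h3
      rw [h3, mul_zero] at h2
      rw [← h2]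
      refine Finset.sum_congr rfl fun y _ => ?_
      rw [front_barSimplex (by omega), back_barSimplex h]
      congr 2
      refine barSimplex_congr fun i _ => ?_
      simp only [evenEdges, oddEdges]
      by_cases hi : i % 2 = 0
      · rw [if_neg (by omega), if_pos hi]
      · rw [if_pos (by omega), if_neg hi]
        congr 1
        omega
  · rintro ⟨k, l⟩ h
    rw [Finset.HasAntidiagonal.mem_antidiagonal] at h
    dsimp only at h
    subst h
    have h2 := sum_extend_split k l
      (fun x => f (2 * k) (barSimplex (2 * k) (evenEdges x)))
      (fun x => g (2 * l) (barSimplex (2 * l) (evenEdges x)))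
      (fun x x' hx => by
        rw [barSimplex_congr fun i hi => ?_]
        simp only [evenEdges, hx (i / 2) (by omega)])
    refine h2.symm.trans (Finset.sum_congr rfl fun y _ => ?_)
    rw [front_barSimplex (by omega), back_barSimplex (a := 2 * k) (by ring)]
    congr 2
    refine barSimplex_congr fun i _ => ?_
    simp only [evenEdges]
    by_cases hi : i % 2 = 0
    · rw [if_pos hi, if_pos (by omega)]
      congr 1
      omega
    · rw [if_neg hi, if_neg (by omega)]

theorem evenEval_add (m : ℕ) (f g : Cochains (BDisc (Multiplicative (ZMod p)))) :
    evenEval m (f + g) = evenEval m f + evenEval m g :=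
  Finset.sum_add_distrib

theorem evenEval_one (m : ℕ) :
    evenEval m (1 : Cochains (BDisc (Multiplicative (ZMod p)))) = if m = 0 then 1 else 0 := by
  cases m with
  | zero =>
    rw [evenEval, if_pos rfl]
    simp [one_apply]
  | succ m =>
    rw [if_neg (by omega)]
    refine Finset.sum_eq_zero fun y _ => ?_
    rw [one_apply, if_neg (by omega)]

/-- Evaluation of integral cocycles on the even chains, modulo `p`, as a power series. -/
def cocycleSeries : Cocycles (BDisc (Multiplicative (ZMod p))) →+* PowerSeries (ZMod p) where
  toFun z := PowerSeries.mk fun m => (evenEval m z.1 : ZMod p)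
  map_zero' := by
    ext m
    rw [PowerSeries.coeff_mk, map_zero]
    have : evenEval m (0 : Cochains (BDisc (Multiplicative (ZMod p)))) = 0 :=
      Finset.sum_eq_zero fun _ _ => rfl
    exact (congrArg (Int.cast : ℤ → ZMod p) this).trans Int.cast_zero
  map_one' := by
    ext m
    rw [PowerSeries.coeff_mk, PowerSeries.coeff_one]
    change ((evenEval m 1 : ℤ) : ZMod p) = _
    rw [evenEval_one]
    split_ifs <;> simp
  map_add' z w := by
    ext m
    rw [map_add, PowerSeries.coeff_mk, PowerSeries.coeff_mk, PowerSeries.coeff_mk, ← Int.cast_add,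
      ← evenEval_add]
    rfl
  map_mul' z w := by
    ext m
    rw [PowerSeries.coeff_mul]
    simp only [PowerSeries.coeff_mk]
    change ((evenEval m (z.1 * w.1) : ℤ) : ZMod p) = _
    rw [evenEval_mul m z.1 w.1 w.2.2]
    push_cast
    rfl

/-- The ring homomorphism `H^*(ℤ/p; ℤ) → 𝔽_p⟦X⟧` that evaluates a class of degree `2 m` on the
generator of `H_{2m}(ℤ/p; 𝔽_p)` and kills the classes of odd degree. -/
def series : HGrp (Multiplicative (ZMod p)) →+* PowerSeries (ZMod p) :=
  Ideal.Quotient.lift (Coboundaries _) cocycleSeries (by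
    rintro z ⟨y, -, hy⟩
    ext m
    change (PowerSeries.coeff m) (PowerSeries.mk fun m => ((evenEval m z.1 : ℤ) : ZMod p)) = _
    rw [PowerSeries.coeff_mk, ← hy, map_zero]
    cases m with
    | zero =>
      have : evenEval 0 (d y) = 0 := Finset.sum_eq_zero fun _ _ => rfl
      rw [this, Int.cast_zero]
    | succ m => rw [evenEval_d]; simp)

theorem coeff_series_mk (z : Cocycles (BDisc (Multiplicative (ZMod p)))) (m : ℕ) :
    PowerSeries.coeff m (series (H.mk _ z)) = evenEval m z.1 :=
  PowerSeries.coeff_mk m fun m => ((evenEval m z.1 : ℤ) : ZMod p)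

theorem series_c₁ (χ : Multiplicative (ZMod p) →* Circle) (k : ℤ)
    (hχ : χ (Multiplicative.ofAdd 1) = Circle.exp (2 * Real.pi * (k / p))) :
    series (c₁ χ) = PowerSeries.C (k : ZMod p) * PowerSeries.X := by
  ext m
  rw [← mk_chernCocycle, coeff_series_mk, PowerSeries.coeff_C_mul, PowerSeries.coeff_X]
  by_cases hm : m = 1
  · subst hm
    rw [if_pos rfl, mul_one]
    have hp : (p : ℝ) ≠ 0 := by exact_mod_cast NeZero.ne p
    have h1 : ((evenEval 1 (chernCocycle χ).1 : ℤ) : ℝ) =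
        p * angle (χ (Multiplicative.ofAdd 1)) := by
      rw [evenEval]
      push_cast
      have h2 : ∀ y : Fin 1 → ZMod p,
          (((chernCocycle χ).1 2 (barSimplex 2 (evenEdges (extend y))) : ℤ) : ℝ) =
          angle (χ (Multiplicative.ofAdd (y 0))) + angle (χ (Multiplicative.ofAdd 1)) -
            angle (χ (Multiplicative.ofAdd (y 0 + 1))) := by
        intro y
        rw [chernCocycle_two]
        have e1 : (barSimplex 2 (evenEdges (extend y))).1 (0 : Fin 3) (1 : Fin 3) =
            Multiplicative.ofAdd (y 0) := by
          change Multiplicative.ofAdd (∑ l ∈ Finset.range 1, _ - ∑ l ∈ Finset.range 0, _) = _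
          simp [evenEdges, extend]
        have e2 : (barSimplex 2 (evenEdges (extend y))).1 (1 : Fin 3) (2 : Fin 3) =
            Multiplicative.ofAdd 1 := by
          change Multiplicative.ofAdd (∑ l ∈ Finset.range 2, _ - ∑ l ∈ Finset.range 1, _) = _
          simp [evenEdges, Finset.sum_range_succ]
        have e3 : (barSimplex 2 (evenEdges (extend y))).1 (0 : Fin 3) (2 : Fin 3) =
            Multiplicative.ofAdd (y 0 + 1) := by
          change Multiplicative.ofAdd (∑ l ∈ Finset.range 2, _ - ∑ l ∈ Finset.range 0, _) = _
          simp [evenEdges, extend, Finset.sum_range_succ]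
        rw [e1, e2, e3]
      refine (Finset.sum_congr rfl fun y _ => h2 y).trans ?_
      rw [← (Equiv.funUnique (Fin 1) (ZMod p)).symm.sum_comp]
      simp only [Equiv.funUnique_symm_apply, uniqueElim_const, Finset.sum_sub_distrib,
        Finset.sum_add_distrib]
      have h4 : ∑ a : ZMod p, angle (χ (Multiplicative.ofAdd (a + 1))) =
          ∑ a : ZMod p, angle (χ (Multiplicative.ofAdd a)) :=
        Equiv.sum_comp (Equiv.addRight (1 : ZMod p)) fun a => angle (χ (Multiplicative.ofAdd a))
      rw [h4]
      simp
    have h3 : Circle.exp (2 * Real.pi * (angle (χ (Multiplicative.ofAdd 1)) - k / p)) = 1 := by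
      rw [mul_sub, Circle.exp_sub, exp_angle, hχ, div_self']
    obtain ⟨j, hj⟩ := Circle.exp_eq_one.mp h3
    have h4 : angle (χ (Multiplicative.ofAdd 1)) - k / p = j := by
      refine mul_left_cancel₀ (by positivity : (2 * Real.pi) ≠ 0) ?_
      rw [hj, mul_comm]
    have h5 : evenEval 1 (chernCocycle χ).1 = k + p * j := by
      have : ((evenEval 1 (chernCocycle χ).1 : ℤ) : ℝ) = ((k + p * j : ℤ) : ℝ) := by
        rw [h1, eq_add_of_sub_eq h4]
        push_cast
        field_simp
        ring
      exact_mod_cast this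
    rw [h5]
    simp
  · rw [if_neg hm, mul_zero]
    have : evenEval m (chernCocycle χ).1 = 0 :=
      Finset.sum_eq_zero fun y _ => chernCocycle_ne χ _ (by omega) _
    rw [this, Int.cast_zero]

end Cyclic

/-! ### Transfer from a normal subgroup -/

section Transfer

variable {G Q : Type} [Group G] [Group Q] {φ : G →* Q} {σ : Q → G}
  (hσ : ∀ q, φ (σ q) = q) {M : Subgroup G} (hM : ∀ g, φ g = 1 → g ∈ M)

/-- Let `σ` be a section of `φ : G → Q` and `ker φ ≤ M`. The lift of the simplex `s` of `BG` to the
covering with fibre `Q` that starts at `q`, mapped to `BM` by the gauge transformation `σ`. -/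
def liftSimplex (q : Q) {n : ℕ} (s : (BDisc G) _⦋n⦌) : (BDisc M) _⦋n⦌ :=
  ⟨fun i j => ⟨σ (q * φ (s.1 (0 : Fin (n + 1)) i)) * s.1 i j *
      (σ (q * φ (s.1 (0 : Fin (n + 1)) j)))⁻¹, hM _ (by
        rw [← s.2 (0 : Fin (n + 1)) i j]
        simp only [map_mul, map_inv, hσ]
        group)⟩, fun i j k => by
    refine Subtype.ext ?_
    change σ (q * φ (s.1 (0 : Fin (n + 1)) i)) * s.1 i j * (σ (q * φ (s.1 (0 : Fin (n + 1)) j)))⁻¹ *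
      (σ (q * φ (s.1 (0 : Fin (n + 1)) j)) * s.1 j k * (σ (q * φ (s.1 (0 : Fin (n + 1)) k)))⁻¹) =
      σ (q * φ (s.1 (0 : Fin (n + 1)) i)) * s.1 i k * (σ (q * φ (s.1 (0 : Fin (n + 1)) k)))⁻¹
    rw [← s.2 i j k]
    group⟩

theorem act_liftSimplex (q : Q) {m n : ℕ} (f : Fin (m + 1) →o Fin (n + 1)) (s : (BDisc G) _⦋n⦌) :
    act (BDisc M) f (liftSimplex hσ hM q s) =
      liftSimplex hσ hM (q * φ (s.1 (0 : Fin (n + 1)) (f 0))) (act (BDisc G) f s) := by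
  have h : ∀ i : Fin (m + 1), q * φ (s.1 (0 : Fin (n + 1)) (f i)) =
      q * φ (s.1 (0 : Fin (n + 1)) (f 0)) * φ (s.1 (f 0) (f i)) := by
    intro i
    rw [mul_assoc, ← map_mul, s.2]
  refine Subtype.ext (funext fun i => funext fun j => Subtype.ext ?_)
  change σ (q * φ (s.1 (0 : Fin (n + 1)) (f i))) * s.1 (f i) (f j) *
      (σ (q * φ (s.1 (0 : Fin (n + 1)) (f j))))⁻¹ =
    σ (q * φ (s.1 (0 : Fin (n + 1)) (f 0)) * φ (s.1 (f 0) (f i))) * s.1 (f i) (f j) *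
      (σ (q * φ (s.1 (0 : Fin (n + 1)) (f 0)) * φ (s.1 (f 0) (f j))))⁻¹
  rw [h i, h j]

variable [Fintype Q]

/-- The transfer of cochains: the sum over all lifts of a simplex. -/
def transferCochain (f : Cochains (BDisc M)) : Cochains (BDisc G) where
  toFun n s := ∑ q : Q, f n (liftSimplex hσ hM q s)

theorem d_transferCochain (f : Cochains (BDisc M)) :
    d (transferCochain hσ hM f) = transferCochain hσ hM (d f) := by
  ext n s
  cases n with
  | zero => exact (Finset.sum_const_zero).symm
  | succ n =>
    change ∑ i ∈ Finset.range (n + 2), (-1) ^ i * ∑ q : Q, _ =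
      ∑ q : Q, ∑ i ∈ Finset.range (n + 2), _
    rw [Finset.sum_comm]
    refine Finset.sum_congr rfl fun i _ => ?_
    simp only [act_liftSimplex]
    rw [← Finset.mul_sum]
    congr 1
    exact (Equiv.sum_comp (Equiv.mulRight (φ (s.1 (0 : Fin (n + 2)) (face n i 0))))
      fun q => f n (liftSimplex hσ hM q (act (BDisc G) (face n i) s))).symm

/-- The transfer of cocycles. -/
def transferCocycle (z : Cocycles (BDisc M)) : Cocycles (BDisc G) :=
  ⟨transferCochain hσ hM z.1, by
    obtain ⟨N, hN⟩ := z.2.1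
    refine ⟨N, fun n hn => funext fun s => ?_⟩
    change ∑ q : Q, z.1 n _ = 0
    rw [hN n hn]
    simp, by
    rw [d_transferCochain, z.2.2]
    ext n s
    exact Finset.sum_const_zero⟩

/-- The double coset formula, for a subgroup that `φ` kills. -/
theorem map_transferCocycle {L : Type} [Group L] (j : L →* G) (hj : ∀ l, φ (j l) = 1)
    (κ : Q → L →* M) (hκ : ∀ q l, (κ q l : G) = σ q * j l * (σ q)⁻¹) (z : Cocycles (BDisc M)) :
    HGrp.map j (H.mk _ (transferCocycle hσ hM z)) = ∑ q : Q, HGrp.map (κ q) (H.mk _ z) := by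
  have h : pullCocycle (BDisc.map j) (transferCocycle hσ hM z) =
      ∑ q : Q, pullCocycle (BDisc.map (κ q)) z := by
    refine Subtype.ext ?_
    rw [AddSubmonoidClass.coe_finsetSum]
    ext n s
    have hs : ∀ (T : Finset Q) (F : Q → Cochains (BDisc L)),
        (∑ q ∈ T, F q) n s = ∑ q ∈ T, F q n s := by
      intro T F
      classical
      induction T using Finset.induction_on with
      | empty => rfl
      | insert a T ha ih => rw [Finset.sum_insert ha, Finset.sum_insert ha, ← ih, add_apply]
    rw [hs]
    refine Finset.sum_congr rfl fun q _ => congrArg (z.1 n) ?_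
    refine Subtype.ext (funext fun x => funext fun y => Subtype.ext ?_)
    change σ (q * φ (j (s.1 (0 : Fin (n + 1)) x))) * j (s.1 x y) *
      (σ (q * φ (j (s.1 (0 : Fin (n + 1)) y))))⁻¹ = (κ q (s.1 x y) : G)
    rw [hj, hj, mul_one, hκ]
  change H.mk _ (pullCocycle (BDisc.map j) (transferCocycle hσ hM z)) = _
  rw [h, map_sum]
  rfl

include hσ hM in
/-- Every sum of conjugates of an even class of `M` extends to an even class of `G`. -/
theorem exists_even_map_eq_sum {L : Type} [Group L] (j : L →* G) (hj : ∀ l, φ (j l) = 1)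
    (κ : Q → L →* M) (hκ : ∀ q l, (κ q l : G) = σ q * j l * (σ q)⁻¹) {x : HGrp M}
    (hx : x ∈ Heven M) : ∃ y ∈ Heven G, HGrp.map j y = ∑ q : Q, HGrp.map (κ q) x := by
  obtain ⟨z, hz, rfl⟩ := hx
  refine ⟨_, ⟨transferCocycle hσ hM z, fun n hn => funext fun s => ?_, rfl⟩,
    map_transferCocycle hσ hM j hj κ hκ z⟩
  change ∑ q : Q, z.1 n _ = 0
  rw [hz n hn]
  simp

end Transfer

end

/-! ### A normal form for `G(n, ε)` -/

section Coordinates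

variable {p : ℕ} {k : ℕ}

/-- Reduction `ℤ/p^(k+2) → ℤ/p`. -/
def reduce (p k : ℕ) : ZMod (p ^ (k + 2)) →+* ZMod p :=
  ZMod.castHom (dvd_pow_self p (by omega)) (ZMod p)

/-- The embedding `ℤ/p → ℤ/p^(k+2)`, `x ↦ p^(k+1) x`. -/
def embed (p k : ℕ) : ZMod p →+ ZMod (p ^ (k + 2)) :=
  ZMod.lift p ⟨zmultiplesHom _ ((p : ZMod (p ^ (k + 2))) ^ (k + 1)), by
    change (p : ℤ) • (p : ZMod (p ^ (k + 2))) ^ (k + 1) = 0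
    rw [zsmul_eq_mul, Int.cast_natCast, ← pow_succ', ← Nat.cast_pow, ZMod.natCast_self]⟩

theorem embed_intCast (j : ℤ) : embed p k (j : ZMod p) = j * (p : ZMod (p ^ (k + 2))) ^ (k + 1) := by
  rw [embed, ZMod.lift_coe]
  change j • (p : ZMod (p ^ (k + 2))) ^ (k + 1) = _
  rw [zsmul_eq_mul]

theorem reduce_embed (x : ZMod p) : reduce p k (embed p k x) = 0 := by
  obtain ⟨j, rfl⟩ := ZMod.intCast_surjective x
  rw [embed_intCast, map_mul, map_pow, map_natCast, ZMod.natCast_self, zero_pow (by omega),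
    mul_zero]

theorem embed_injective [NeZero p] : Function.Injective (embed p k) := by
  rw [injective_iff_map_eq_zero]
  intro x hx
  obtain ⟨j, rfl⟩ := ZMod.intCast_surjective x
  rw [embed_intCast, ← Nat.cast_pow, ← Int.cast_natCast (R := ZMod (p ^ (k + 2))), ← Int.cast_mul,
    ZMod.intCast_zmod_eq_zero_iff_dvd, pow_succ p (k + 1), mul_comm j] at hx
  rw [ZMod.intCast_zmod_eq_zero_iff_dvd]
  push_cast at hx
  exact Int.dvd_of_mul_dvd_mul_left (pow_ne_zero _ (by exact_mod_cast NeZero.ne p)) hx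

theorem exists_embed_eq [NeZero p] {c : ZMod (p ^ (k + 2))} (hc : (p : ZMod (p ^ (k + 2))) * c = 0) :
    ∃ x, embed p k x = c := by
  obtain ⟨j, rfl⟩ := ZMod.intCast_surjective c
  rw [← Int.cast_natCast (R := ZMod (p ^ (k + 2))), ← Int.cast_mul,
    ZMod.intCast_zmod_eq_zero_iff_dvd, pow_succ' p (k + 1)] at hc
  push_cast at hc
  obtain ⟨i, rfl⟩ := Int.dvd_of_mul_dvd_mul_left (by exact_mod_cast NeZero.ne p) hc
  refine ⟨i, ?_⟩
  rw [embed_intCast]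
  push_cast
  ring

end Coordinates

/-- The triples `(a, b, c)` that stand for the elements `A^a B^b C^c` of `G(k + 4, ε)`. -/
@[ext] structure NormalForm (p k : ℕ) (ε : ℤ) : Type where
  /-- the exponent of `A` -/
  a : ZMod p
  /-- the exponent of `B` -/
  b : ZMod p
  /-- the exponent of `C` -/
  c : ZMod (p ^ (k + 2))

namespace NormalForm

variable {p k : ℕ} {ε : ℤ} [hp : Fact p.Prime]

theorem two_ne_zero [hp5 : Fact (5 ≤ p)] : (2 : ZMod p) ≠ 0 := by
  intro h
  have h2 : ((2 : ℕ) : ZMod p) = 0 := by exact_mod_cast h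
  have := Nat.le_of_dvd (by omega) ((ZMod.natCast_eq_zero_iff 2 p).mp h2)
  have := hp5.out
  omega

/-- The binomial coefficient `x (x - 1) / 2`. -/
def tri (x : ZMod p) : ZMod p := x * (x - 1) / 2

theorem tri_zero : tri (0 : ZMod p) = 0 := by simp [tri]

theorem tri_one : tri (1 : ZMod p) = 0 := by simp [tri]

theorem tri_add [Fact (5 ≤ p)] (x y : ZMod p) : tri (x + y) = tri x + tri y + x * y := by
  have := two_ne_zero (p := p)
  unfold tri
  field_simp
  ring

instance : Mul (NormalForm p k ε) where
  mul x y := ⟨x.a + y.a, x.b + y.a * reduce p k x.c + y.b,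
    x.c + embed p k (ε * (y.a * x.b + tri y.a * reduce p k x.c)) + y.c⟩

instance : One (NormalForm p k ε) := ⟨⟨0, 0, 0⟩⟩

instance : Inv (NormalForm p k ε) where
  inv x := ⟨-x.a, x.a * reduce p k x.c - x.b,
    -x.c - embed p k (ε * (x.a * (x.a * reduce p k x.c - x.b) - tri x.a * reduce p k x.c))⟩

theorem mul_def (x y : NormalForm p k ε) : x * y = ⟨x.a + y.a, x.b + y.a * reduce p k x.c + y.b,
    x.c + embed p k (ε * (y.a * x.b + tri y.a * reduce p k x.c)) + y.c⟩ := rfl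

theorem one_def : (1 : NormalForm p k ε) = ⟨0, 0, 0⟩ := rfl

theorem inv_def (x : NormalForm p k ε) : x⁻¹ = ⟨-x.a, x.a * reduce p k x.c - x.b,
    -x.c - embed p k (ε * (x.a * (x.a * reduce p k x.c - x.b) - tri x.a * reduce p k x.c))⟩ := rfl

theorem mk_mul_mk (a b : ZMod p) (b' : ZMod p) (c c' : ZMod (p ^ (k + 2))) :
    (⟨a, b, c⟩ * ⟨0, b', c'⟩ : NormalForm p k ε) = ⟨a, b + b', c + c'⟩ := by
  simp only [mul_def, tri_zero, zero_mul, mul_zero, map_zero, add_zero]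

variable [hp5 : Fact (5 ≤ p)]

instance : Group (NormalForm p k ε) :=
  Group.ofLeftAxioms
    (fun x y z => by
      simp only [mul_def, map_add, reduce_embed, tri_add]
      ext
      · simp only [add_assoc]
      · simp only
        ring
      · simp only [mul_add, add_mul, map_add, add_zero]
        rw [show (ε : ZMod p) * (z.a * (y.a * reduce p k x.c)) =
          ε * (y.a * z.a * reduce p k x.c) by ring]
        abel)
    (fun x => by
      simp only [mul_def, one_def, map_zero, mul_zero, add_zero, zero_add])
    (fun x => by
      simp only [mul_def, one_def, inv_def, map_sub, map_neg, reduce_embed, sub_zero]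
      ext
      · simp only [neg_add_cancel]
      · simp only
        ring
      · simp only
        rw [show (ε : ZMod p) * (x.a * (x.a * reduce p k x.c - x.b) + tri x.a * -reduce p k x.c) =
          ε * (x.a * (x.a * reduce p k x.c - x.b) - tri x.a * reduce p k x.c) by ring]
        abel)

/-- The elements `B^b C^c`. -/
def fibre (p k : ℕ) (ε : ℤ) [Fact p.Prime] [Fact (5 ≤ p)] :
    Multiplicative (ZMod p × ZMod (p ^ (k + 2))) →* NormalForm p k ε where
  toFun x := ⟨0, x.toAdd.1, x.toAdd.2⟩
  map_one' := rfl
  map_mul' x y := by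
    simp only [mul_def, tri_zero, zero_mul, mul_zero, map_zero, add_zero]
    rfl

theorem mk_b_zpow (b : ZMod p) (j : ℤ) : (⟨0, b, 0⟩ : NormalForm p k ε) ^ j = ⟨0, j * b, 0⟩ := by
  have h := map_zpow (fibre p k ε) (Multiplicative.ofAdd (b, 0)) j
  rw [← ofAdd_zsmul] at h
  refine h.symm.trans ?_
  change NormalForm.mk 0 (j • b) (j • (0 : ZMod (p ^ (k + 2)))) = _
  rw [zsmul_eq_mul, smul_zero]

theorem mk_c_zpow (c : ZMod (p ^ (k + 2))) (j : ℤ) :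
    (⟨0, 0, c⟩ : NormalForm p k ε) ^ j = ⟨0, 0, j * c⟩ := by
  have h := map_zpow (fibre p k ε) (Multiplicative.ofAdd (0, c)) j
  rw [← ofAdd_zsmul] at h
  refine h.symm.trans ?_
  change NormalForm.mk 0 (j • (0 : ZMod p)) (j • c) = _
  rw [smul_zero, zsmul_eq_mul]

theorem mk_a_zpow (a : ZMod p) (j : ℤ) : (⟨a, 0, 0⟩ : NormalForm p k ε) ^ j = ⟨j * a, 0, 0⟩ := by
  let F : Multiplicative (ZMod p) →* NormalForm p k ε :=
    { toFun := fun x => ⟨x.toAdd, 0, 0⟩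
      map_one' := rfl
      map_mul' := fun x y => by
        simp only [mul_def, map_zero, mul_zero, add_zero]
        rfl }
  have h := map_zpow F (Multiplicative.ofAdd a) j
  rw [← ofAdd_zsmul] at h
  refine h.symm.trans ?_
  change NormalForm.mk (j • a) 0 0 = _
  rw [zsmul_eq_mul]

/-- The underlying set of triples. -/
def equivProd (p k : ℕ) (ε : ℤ) :
    NormalForm p k ε ≃ ZMod p × ZMod p × ZMod (p ^ (k + 2)) where
  toFun x := (x.a, x.b, x.c)
  invFun x := ⟨x.1, x.2.1, x.2.2⟩
  left_inv _ := rfl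
  right_inv _ := rfl

/-- The exponent of `A`, as a homomorphism. -/
def exponentA (p k : ℕ) (ε : ℤ) [Fact p.Prime] [Fact (5 ≤ p)] :
    NormalForm p k ε →* Multiplicative (ZMod p) where
  toFun x := Multiplicative.ofAdd x.a
  map_one' := rfl
  map_mul' _ _ := rfl

end NormalForm

namespace GG

section Relations

variable {p k : ℕ} {ε : ℤ}

/-- The generator `A` of `G(n, ε)`. -/
def A (p n : ℕ) (ε : ℤ) : GG p n ε := PresentedGroup.of Gen.A

theorem mk_relator {r : FreeGroup Gen} (hr : r ∈ relators p (k + 4) ε) :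
    PresentedGroup.mk (relators p (k + 4) ε) r = 1 :=
  (QuotientGroup.eq_one_iff r).mpr (Subgroup.subset_normalClosure hr)

theorem A_pow : A p (k + 4) ε ^ p = 1 :=
  mk_relator (r := FreeGroup.of Gen.A ^ p) (Or.inl rfl)

theorem B_pow : B p (k + 4) ε ^ p = 1 :=
  mk_relator (r := FreeGroup.of Gen.B ^ p) (Or.inr (Or.inl rfl))

theorem C_pow : C p (k + 4) ε ^ (p ^ (k + 2)) = 1 :=
  mk_relator (r := FreeGroup.of Gen.C ^ (p ^ (k + 2))) (Or.inr (Or.inr (Or.inl rfl)))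

theorem commute_B_C : Commute (B p (k + 4) ε) (C p (k + 4) ε) := by
  have h : comm (B p (k + 4) ε) (C p (k + 4) ε) = 1 :=
    mk_relator (r := comm (FreeGroup.of Gen.B) (FreeGroup.of Gen.C))
      (Or.inr (Or.inr (Or.inr (Or.inl rfl))))
  have h2 : B p (k + 4) ε * C p (k + 4) ε = C p (k + 4) ε * B p (k + 4) ε *
    comm (B p (k + 4) ε) (C p (k + 4) ε) := by
    unfold comm
    group
  rwa [h, mul_one] at h2

theorem C_mul_A : C p (k + 4) ε * A p (k + 4) ε =
    A p (k + 4) ε * (B p (k + 4) ε * C p (k + 4) ε) := by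
  have h : comm (A p (k + 4) ε) (C p (k + 4) ε)⁻¹ * (B p (k + 4) ε)⁻¹ = 1 :=
    mk_relator (r := comm (FreeGroup.of Gen.A) (FreeGroup.of Gen.C)⁻¹ * (FreeGroup.of Gen.B)⁻¹)
      (Or.inr (Or.inr (Or.inr (Or.inr (Or.inl rfl)))))
  rw [← mul_inv_eq_one.mp h]
  unfold comm
  group

/-- The central element `Z = C^(p^(n-3))` of order `p`. -/
def Z (p k : ℕ) (ε : ℤ) : GG p (k + 4) ε := C p (k + 4) ε ^ (p ^ (k + 1))

theorem B_mul_A : B p (k + 4) ε * A p (k + 4) ε =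
    A p (k + 4) ε * (B p (k + 4) ε * Z p k ε ^ ε) := by
  have h : comm (B p (k + 4) ε) (A p (k + 4) ε) * (C p (k + 4) ε ^ (ε * (p : ℤ) ^ (k + 1)))⁻¹ = 1 :=
    mk_relator (r := comm (FreeGroup.of Gen.B) (FreeGroup.of Gen.A) *
      (FreeGroup.of Gen.C ^ (ε * (p : ℤ) ^ (k + 1)))⁻¹)
      (Or.inr (Or.inr (Or.inr (Or.inr (Or.inr rfl)))))
  have h2 : Z p k ε ^ ε = C p (k + 4) ε ^ (ε * (p : ℤ) ^ (k + 1)) := by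
    rw [Z, ← zpow_natCast, ← zpow_mul, mul_comm]
    push_cast
    rfl
  rw [h2, ← mul_inv_eq_one.mp h]
  unfold comm
  group

theorem commute_B_Z : Commute (B p (k + 4) ε) (Z p k ε) := commute_B_C.pow_right _

theorem commute_C_Z : Commute (C p (k + 4) ε) (Z p k ε) := (Commute.refl _).pow_right _

theorem B_zpow_mul_A (j : ℤ) : B p (k + 4) ε ^ j * A p (k + 4) ε =
    A p (k + 4) ε * (B p (k + 4) ε ^ j * Z p k ε ^ (ε * j)) := by
  have h : (A p (k + 4) ε)⁻¹ * B p (k + 4) ε * ((A p (k + 4) ε)⁻¹)⁻¹ =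
      B p (k + 4) ε * Z p k ε ^ ε := by
    rw [inv_inv, mul_assoc, B_mul_A]
    group
  have h2 := congrArg (· ^ j) h
  simp only [conj_zpow] at h2
  rw [(commute_B_Z.zpow_right ε).mul_zpow, ← zpow_mul] at h2
  rw [← h2]
  group

theorem C_zpow_mul_A (j : ℤ) : C p (k + 4) ε ^ j * A p (k + 4) ε =
    A p (k + 4) ε * (B p (k + 4) ε ^ j * C p (k + 4) ε ^ j) := by
  have h : (A p (k + 4) ε)⁻¹ * C p (k + 4) ε * ((A p (k + 4) ε)⁻¹)⁻¹ =
      B p (k + 4) ε * C p (k + 4) ε := by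
    rw [inv_inv, mul_assoc, C_mul_A]
    group
  have h2 := congrArg (· ^ j) h
  simp only [conj_zpow] at h2
  rw [commute_B_C.mul_zpow] at h2
  rw [← h2]
  group

theorem zpow_mul_A (i j l : ℤ) :
    A p (k + 4) ε ^ i * B p (k + 4) ε ^ j * C p (k + 4) ε ^ l * A p (k + 4) ε =
      A p (k + 4) ε ^ (i + 1) * B p (k + 4) ε ^ (j + l) *
        C p (k + 4) ε ^ (p ^ (k + 1) * (ε * j) + l) := by
  rw [mul_assoc _ _ (A p (k + 4) ε), C_zpow_mul_A, ← mul_assoc, mul_assoc _ _ (A p (k + 4) ε),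
    B_zpow_mul_A, zpow_add_one, zpow_add (B p (k + 4) ε), zpow_add (C p (k + 4) ε)]
  have hZ : Z p k ε ^ (ε * j) = C p (k + 4) ε ^ ((p : ℤ) ^ (k + 1) * (ε * j)) := by
    rw [Z, ← zpow_natCast, ← zpow_mul]
    push_cast
    rfl
  have hc : Commute (C p (k + 4) ε ^ ((p : ℤ) ^ (k + 1) * (ε * j))) (B p (k + 4) ε ^ l) :=
    (commute_B_C.symm.zpow_left _).zpow_right _
  rw [hZ]
  simp only [mul_assoc]
  rw [← mul_assoc (C p (k + 4) ε ^ _) (B p (k + 4) ε ^ l), hc.eq, mul_assoc]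

theorem exists_eq_zpow [NeZero p] (g : GG p (k + 4) ε) : ∃ i j l : ℤ,
    g = A p (k + 4) ε ^ i * B p (k + 4) ε ^ j * C p (k + 4) ε ^ l := by
  have hA : ∀ (m : ℕ) (g : GG p (k + 4) ε), (∃ i j l : ℤ,
      g = A p (k + 4) ε ^ i * B p (k + 4) ε ^ j * C p (k + 4) ε ^ l) → ∃ i j l : ℤ,
      g * A p (k + 4) ε ^ m = A p (k + 4) ε ^ i * B p (k + 4) ε ^ j * C p (k + 4) ε ^ l := by
    intro m
    induction m with
    | zero => intro g h; rwa [pow_zero, mul_one]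
    | succ m ih =>
      intro g h
      obtain ⟨i, j, l, h⟩ := ih g h
      rw [pow_succ, ← mul_assoc, h, zpow_mul_A]
      exact ⟨_, _, _, rfl⟩
  have hinv : (A p (k + 4) ε)⁻¹ = A p (k + 4) ε ^ (p - 1) := by
    rw [inv_eq_iff_mul_eq_one, ← pow_succ', Nat.sub_add_cancel NeZero.one_le, A_pow]
  have hcl : g ∈ Subgroup.closure (Set.range (PresentedGroup.of (rels := relators p (k + 4) ε))) := by
    rw [PresentedGroup.closure_range_of]
    trivial
  induction hcl using Subgroup.closure_induction_right with
  | one => exact ⟨0, 0, 0, by simp⟩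
  | mul_right x hx y hy ih =>
    obtain ⟨i, j, l, rfl⟩ := ih
    obtain ⟨_ | _ | _, rfl⟩ := hy
    · exact ⟨_, _, _, zpow_mul_A i j l⟩
    · refine ⟨i, j + 1, l, ?_⟩
      change _ * B p (k + 4) ε = _
      rw [mul_assoc, ← (commute_B_C.zpow_right l).eq, zpow_add_one]
      simp only [mul_assoc]
    · refine ⟨i, j, l + 1, ?_⟩
      change _ * C p (k + 4) ε = _
      rw [mul_assoc, zpow_add_one]
  | mul_inv_cancel x hx y hy ih =>
    obtain ⟨_ | _ | _, rfl⟩ := hy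
    · change ∃ i j l : ℤ, x * (A p (k + 4) ε)⁻¹ = _
      rw [hinv]
      exact hA _ _ ih
    · obtain ⟨i, j, l, rfl⟩ := ih
      refine ⟨i, j - 1, l, ?_⟩
      change _ * (B p (k + 4) ε)⁻¹ = _
      rw [mul_assoc, ← (commute_B_C.zpow_right l).inv_left.eq, zpow_sub_one]
      simp only [mul_assoc]
    · obtain ⟨i, j, l, rfl⟩ := ih
      refine ⟨i, j, l - 1, ?_⟩
      change _ * (C p (k + 4) ε)⁻¹ = _
      rw [mul_assoc, zpow_sub_one]

end Relations

section Coordinates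

variable (p k : ℕ) (ε : ℤ) [hp : Fact p.Prime] [hp5 : Fact (5 ≤ p)]

/-- The triple that is assigned to a generator. -/
def genTriple : Gen → NormalForm p k ε
  | Gen.A => ⟨1, 0, 0⟩
  | Gen.B => ⟨0, 1, 0⟩
  | Gen.C => ⟨0, 0, 1⟩

/-- The coordinates of an element of `G(k + 4, ε)`. -/
def coords : GG p (k + 4) ε →* NormalForm p k ε :=
  PresentedGroup.toGroup (f := genTriple p k ε) (by
    have pw : ∀ (x : NormalForm p k ε) (m : ℕ), x ^ m = x ^ (m : ℤ) := fun x m =>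
      (zpow_natCast x m).symm
    have hN : ((p ^ (k + 2) : ℕ) : ZMod (p ^ (k + 2))) = 0 := ZMod.natCast_self _
    rintro r (rfl | rfl | rfl | rfl | rfl | rfl)
    · rw [map_pow, FreeGroup.lift_apply_of, pw, genTriple, NormalForm.mk_a_zpow]
      simp [NormalForm.one_def]
    · rw [map_pow, FreeGroup.lift_apply_of, pw, genTriple, NormalForm.mk_b_zpow]
      simp [NormalForm.one_def]
    · change FreeGroup.lift (genTriple p k ε) (FreeGroup.of Gen.C ^ (p ^ (k + 2))) = 1
      rw [map_pow, FreeGroup.lift_apply_of, pw, genTriple, NormalForm.mk_c_zpow, Int.cast_natCast,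
        hN, zero_mul]
      rfl
    · have h : FreeGroup.lift (genTriple p k ε) (comm (FreeGroup.of Gen.B) (FreeGroup.of Gen.C)) =
          (genTriple p k ε Gen.C * genTriple p k ε Gen.B)⁻¹ *
            (genTriple p k ε Gen.B * genTriple p k ε Gen.C) := by
        simp only [comm, map_mul, map_inv, FreeGroup.lift_apply_of]
        group
      rw [h, inv_mul_eq_one, genTriple, genTriple, NormalForm.mk_mul_mk, NormalForm.mk_mul_mk]
      simp only [zero_add, add_zero]
    · have h : FreeGroup.lift (genTriple p k ε)
          (comm (FreeGroup.of Gen.A) (FreeGroup.of Gen.C)⁻¹ * (FreeGroup.of Gen.B)⁻¹) =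
          (genTriple p k ε Gen.A)⁻¹ * ((genTriple p k ε Gen.C * genTriple p k ε Gen.A) *
            (genTriple p k ε Gen.A * (genTriple p k ε Gen.B * genTriple p k ε Gen.C))⁻¹) *
            genTriple p k ε Gen.A := by
        simp only [comm, map_mul, map_inv, FreeGroup.lift_apply_of]
        group
      have h2 : genTriple p k ε Gen.C * genTriple p k ε Gen.A =
          genTriple p k ε Gen.A * (genTriple p k ε Gen.B * genTriple p k ε Gen.C) := by
        rw [genTriple, genTriple, genTriple, NormalForm.mk_mul_mk, NormalForm.mk_mul_mk,
          NormalForm.mul_def]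
        simp [NormalForm.tri_one]
      rw [h, h2]
      group
    · have h : FreeGroup.lift (genTriple p k ε) (comm (FreeGroup.of Gen.B) (FreeGroup.of Gen.A) *
          (FreeGroup.of Gen.C ^ (ε * (p : ℤ) ^ (k + 1)))⁻¹) =
          (genTriple p k ε Gen.A * genTriple p k ε Gen.B)⁻¹ * (genTriple p k ε Gen.B *
            genTriple p k ε Gen.A) * (genTriple p k ε Gen.C ^ (ε * (p : ℤ) ^ (k + 1)))⁻¹ := by
        simp only [comm, map_mul, map_inv, map_zpow, FreeGroup.lift_apply_of]
        group
      refine h.trans ?_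
      rw [mul_inv_eq_one, inv_mul_eq_iff_eq_mul, genTriple, genTriple, genTriple,
        NormalForm.mk_c_zpow, NormalForm.mk_mul_mk, NormalForm.mk_mul_mk, NormalForm.mul_def]
      simp [NormalForm.tri_one, embed_intCast])

theorem coords_A : coords p k ε (A p (k + 4) ε) = ⟨1, 0, 0⟩ := PresentedGroup.toGroup.of _

theorem coords_B : coords p k ε (B p (k + 4) ε) = ⟨0, 1, 0⟩ := PresentedGroup.toGroup.of _

theorem coords_C : coords p k ε (C p (k + 4) ε) = ⟨0, 0, 1⟩ := PresentedGroup.toGroup.of _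

theorem coords_zpow (i j l : ℤ) :
    coords p k ε (A p (k + 4) ε ^ i * B p (k + 4) ε ^ j * C p (k + 4) ε ^ l) = ⟨i, j, l⟩ := by
  rw [map_mul, map_mul, map_zpow, map_zpow, map_zpow, coords_A, coords_B, coords_C,
    NormalForm.mk_a_zpow, NormalForm.mk_b_zpow, NormalForm.mk_c_zpow, NormalForm.mk_mul_mk,
    NormalForm.mk_mul_mk]
  simp

theorem zpow_eq_one_of_cast {G : Type} [Group G] {g : G} {m : ℕ} (h : g ^ m = 1) {i : ℤ}
    (hi : (i : ZMod m) = 0) : g ^ i = 1 := by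
  obtain ⟨j, rfl⟩ := (ZMod.intCast_zmod_eq_zero_iff_dvd i m).mp hi
  rw [zpow_mul, zpow_natCast, h, one_zpow]

theorem coords_bijective : Function.Bijective (coords p k ε) := by
  constructor
  · rw [injective_iff_map_eq_one]
    intro g hg
    obtain ⟨i, j, l, rfl⟩ := exists_eq_zpow g
    rw [coords_zpow, NormalForm.one_def, NormalForm.mk.injEq] at hg
    rw [zpow_eq_one_of_cast A_pow hg.1, zpow_eq_one_of_cast B_pow hg.2.1,
      zpow_eq_one_of_cast C_pow hg.2.2, one_mul, one_mul]
  · rintro ⟨a, b, c⟩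
    obtain ⟨i, rfl⟩ := ZMod.intCast_surjective a
    obtain ⟨j, rfl⟩ := ZMod.intCast_surjective b
    obtain ⟨l, rfl⟩ := ZMod.intCast_surjective c
    exact ⟨_, coords_zpow p k ε i j l⟩

theorem card_eq : Nat.card (GG p (k + 4) ε) = p ^ (k + 4) := by
  rw [Nat.card_congr (Equiv.ofBijective _ (coords_bijective p k ε)),
    Nat.card_congr (NormalForm.equivProd p k ε), Nat.card_prod, Nat.card_prod, Nat.card_zmod,
    Nat.card_zmod]
  ring

/-- The homomorphism `G(k + 4, ε) → ℤ/p` with `A ↦ 1`, `B ↦ 0`, `C ↦ 0`. -/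
def degA : GG p (k + 4) ε →* Multiplicative (ZMod p) :=
  (NormalForm.exponentA p k ε).comp (coords p k ε)

theorem degA_A : degA p k ε (A p (k + 4) ε) = Multiplicative.ofAdd 1 :=
  congrArg (fun x => Multiplicative.ofAdd x.a) (coords_A p k ε)

theorem degA_B : degA p k ε (B p (k + 4) ε) = 1 :=
  congrArg (fun x => Multiplicative.ofAdd x.a) (coords_B p k ε)

theorem degA_C : degA p k ε (C p (k + 4) ε) = 1 :=
  congrArg (fun x => Multiplicative.ofAdd x.a) (coords_C p k ε)

theorem mem_M_iff (g : GG p (k + 4) ε) : g ∈ M p (k + 4) ε ↔ degA p k ε g = 1 := by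
  constructor
  · intro hg
    have h : M p (k + 4) ε ≤ (degA p k ε).ker := by
      refine (Subgroup.closure_le _).mpr ?_
      rintro x (rfl | rfl)
      · exact degA_B p k ε
      · exact degA_C p k ε
    exact h hg
  · intro hg
    obtain ⟨i, j, l, rfl⟩ := exists_eq_zpow g
    have hi : (i : ZMod p) = 0 := by
      have h := congrArg NormalForm.a (coords_zpow p k ε i j l)
      exact h.symm.trans hg
    rw [zpow_eq_one_of_cast A_pow hi, one_mul]
    exact mul_mem (zpow_mem (B_mem _ _ _) _) (zpow_mem (C_mem _ _ _) _)

end Coordinates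

end GG

namespace GG

/-! ### The `p`-rank -/

section Rank

variable (p k : ℕ) (ε : ℤ) [hp : Fact p.Prime] [hp5 : Fact (5 ≤ p)]

theorem exists_coords_eq {x : GG p (k + 4) ε} (hx : degA p k ε x = 1) :
    ∃ b c, coords p k ε x = NormalForm.fibre p k ε (Multiplicative.ofAdd (b, c)) :=
  ⟨(coords p k ε x).b, (coords p k ε x).c, NormalForm.ext hx rfl rfl⟩

theorem exists_coords_eq_embed {x : GG p (k + 4) ε} (hx : degA p k ε x = 1) (hxp : x ^ p = 1) :
    ∃ b y, coords p k ε x = ⟨0, b, embed p k y⟩ := by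
  obtain ⟨b, c, h⟩ := exists_coords_eq p k ε hx
  have h2 : NormalForm.fibre p k ε (Multiplicative.ofAdd (b, c) ^ p) = 1 := by
    rw [map_pow, ← h, ← map_pow, hxp, map_one]
  have h3 : p • c = 0 := congrArg NormalForm.c h2
  rw [nsmul_eq_mul] at h3
  obtain ⟨y, rfl⟩ := exists_embed_eq h3
  exact ⟨b, y, h⟩

/-- An element outside `M` commutes with an element of order `p` of `M` only if the latter is a power
of `Z`. -/
theorem coords_b_eq_zero (hε : (ε : ZMod p) ≠ 0) {g x : GG p (k + 4) ε} (hg : degA p k ε g ≠ 1)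
    (hc : g * x = x * g) {b y : ZMod p} (hx : coords p k ε x = ⟨0, b, embed p k y⟩) : b = 0 := by
  have h := congrArg (coords p k ε) hc
  rw [map_mul, map_mul, hx] at h
  have hga : (coords p k ε g).a ≠ 0 := hg
  generalize coords p k ε g = u at h hga
  simp only [NormalForm.mul_def, NormalForm.mk.injEq, reduce_embed, NormalForm.tri_zero, zero_mul,
    mul_zero, map_zero, add_zero] at h
  have h3 : embed p k (ε * (u.a * b)) = 0 := by
    have := h.2.2
    rw [add_right_comm, add_comm u.c, left_eq_add] at this
    exact this
  rw [map_eq_zero_iff _ embed_injective, mul_eq_zero, mul_eq_zero] at h3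
  exact (h3.resolve_left hε).resolve_left hga

theorem card_elementary_le (hε : (ε : ZMod p) ≠ 0) (E : Subgroup (GG p (k + 4) ε))
    (hcomm : ∀ x ∈ E, ∀ y ∈ E, x * y = y * x) (hpow : ∀ x ∈ E, x ^ p = 1) :
    Nat.card E ≤ p ^ 2 := by
  have hinj := (coords_bijective p k ε).1
  by_cases h : ∀ x ∈ E, degA p k ε x = 1
  · choose b y hby using fun x : E => exists_coords_eq_embed p k ε (h x x.2) (hpow x x.2)
    have : Function.Injective fun x : E => (b x, y x) := by
      intro x x' hxx
      rw [Prod.mk.injEq] at hxx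
      refine Subtype.ext (hinj ?_)
      rw [hby, hby, hxx.1, hxx.2]
    refine (Nat.card_le_card_of_injective _ this).trans ?_
    rw [Nat.card_prod, Nat.card_zmod, sq]
  · push Not at h
    obtain ⟨g, hgE, hg⟩ := h
    let f : E →* Multiplicative (ZMod p) := (degA p k ε).comp E.subtype
    have hker : Nat.card f.ker ≤ p := by
      choose b y hby using fun x : f.ker =>
        exists_coords_eq_embed p k ε (x := x.1.1) x.2 (hpow x.1.1 x.1.2)
      have : Function.Injective y := by
        intro x x' hxx
        refine Subtype.ext (Subtype.ext (hinj ?_))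
        rw [hby, hby, hxx, coords_b_eq_zero p k ε hε hg (hcomm g hgE x.1.1 x.1.2) (hby x),
          coords_b_eq_zero p k ε hε hg (hcomm g hgE x'.1.1 x'.1.2) (hby x')]
      exact (Nat.card_le_card_of_injective _ this).trans_eq (Nat.card_zmod p)
    rw [← f.ker.card_mul_index, Subgroup.index_ker, sq]
    refine Nat.mul_le_mul hker ?_
    exact (Nat.card_le_card_of_injective _ Subtype.val_injective).trans_eq (Nat.card_zmod p)

theorem isGreatest_rank (hε : (ε : ZMod p) ≠ 0) :
    IsGreatest {r : ℕ | ∃ E : Subgroup (GG p (k + 4) ε),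
      Nonempty (E ≃* Multiplicative (Fin r → ZMod p))} 2 := by
  constructor
  · let F : Multiplicative (Fin 2 → ZMod p) →* NormalForm p k ε :=
      (NormalForm.fibre p k ε).comp (AddMonoidHom.toMultiplicative
        ((Pi.evalAddMonoidHom _ 0).prod ((embed p k).comp (Pi.evalAddMonoidHom _ 1))))
    let e := MulEquiv.ofBijective _ (coords_bijective p k ε)
    let F' := e.symm.toMonoidHom.comp F
    have hF : Function.Injective F := by
      intro x y hxy
      have h0 : x.toAdd 0 = y.toAdd 0 := congrArg NormalForm.b hxy
      have h1 : embed p k (x.toAdd 1) = embed p k (y.toAdd 1) := congrArg NormalForm.c hxy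
      refine Multiplicative.toAdd.injective (funext fun i => ?_)
      fin_cases i
      · exact h0
      · exact embed_injective h1
    have hF' : Function.Injective F' := e.symm.injective.comp hF
    exact ⟨F'.range, ⟨(MonoidHom.ofInjective hF').symm⟩⟩
  · rintro r ⟨E, ⟨e⟩⟩
    have hcard : Nat.card E = p ^ r := by
      rw [Nat.card_congr e.toEquiv, Nat.card_congr Multiplicative.toAdd, Nat.card_fun,
        Nat.card_zmod, Nat.card_fin]
    have h := card_elementary_le p k ε hε E
      (fun x hx y hy => congrArg Subtype.val (show (⟨x, hx⟩ : E) * ⟨y, hy⟩ = ⟨y, hy⟩ * ⟨x, hx⟩ from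
        e.injective (by rw [map_mul, map_mul, mul_comm])))
      (fun x hx => congrArg Subtype.val (show (⟨x, hx⟩ : E) ^ p = 1 from e.injective (by
        rw [map_pow, map_one]
        refine Multiplicative.toAdd.injective (funext fun i => ?_)
        change p • (e ⟨x, hx⟩).toAdd i = 0
        rw [nsmul_eq_mul, ZMod.natCast_self, zero_mul])))
    rw [hcard] at h
    exact (Nat.pow_le_pow_iff_right hp.out.one_lt).mp h

end Rank

/-! ### An even class of `G` that restricts to `β' ^ (p + 1)` -/

theorem cycB_hom_ext {p n : ℕ} {ε : ℤ} {f g : cycB p n ε →* Circle}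
    (h : f ⟨B p n ε, Subgroup.mem_zpowers _⟩ = g ⟨B p n ε, Subgroup.mem_zpowers _⟩) :
    f = g := by
  refine MonoidHom.ext ?_
  rintro ⟨_, i, rfl⟩
  have e : (⟨B p n ε ^ i, ⟨i, rfl⟩⟩ : cycB p n ε) =
      ⟨B p n ε, Subgroup.mem_zpowers _⟩ ^ i := rfl
  change f ⟨B p n ε ^ i, ⟨i, rfl⟩⟩ = g ⟨B p n ε ^ i, ⟨i, rfl⟩⟩
  rw [e, map_zpow, map_zpow, h]

theorem sum_pow_eq_neg_one (p : ℕ) [hp : Fact p.Prime] (ε : ℤ) (hε : (ε : ZMod p) ≠ 0) :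
    ((∑ q : Multiplicative (ZMod p), (-ε * (q.toAdd.val : ℤ)) ^ (p - 1) : ℤ) : ZMod p) = -1 := by
  push_cast
  have h : ∀ q : ZMod p, (-(ε : ZMod p) * (q.val : ZMod p)) ^ (p - 1) = 1 - if q = 0 then 1 else 0 := by
    intro q
    rw [ZMod.natCast_zmod_val]
    split_ifs with hq
    · rw [hq, mul_zero, zero_pow (by have := hp.out.two_le; omega), sub_self]
    · rw [sub_zero]
      exact ZMod.pow_card_sub_one_eq_one (mul_ne_zero (neg_ne_zero.mpr hε) hq)
  refine (Finset.sum_congr rfl fun q _ => h q.toAdd).trans ?_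
  refine (Equiv.sum_comp Multiplicative.toAdd
    fun q : ZMod p => (1 : ZMod p) - if q = 0 then 1 else 0).trans ?_
  simp

theorem toCircle_embed {p k : ℕ} [hp : Fact p.Prime] (x : ZMod p) :
    ZMod.toCircle (embed p k x) = ZMod.toCircle x := by
  obtain ⟨j, rfl⟩ := ZMod.intCast_surjective x
  have h : embed p k (j : ZMod p) = ((j * p ^ (k + 1) : ℤ) : ZMod (p ^ (k + 2))) := by
    rw [embed_intCast]
    push_cast
    rfl
  rw [h]
  ext
  rw [ZMod.toCircle_intCast, ZMod.toCircle_intCast]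
  congr 1
  have : (p : ℂ) ≠ 0 := by exact_mod_cast hp.out.ne_zero
  push_cast
  field_simp
  ring

section Characters

variable (p k : ℕ) (ε : ℤ) [hp : Fact p.Prime] [hp5 : Fact (5 ≤ p)]

/-- The exponents of `B` and `C` of an element of `M`. -/
def coordsM : M p (k + 4) ε →* Multiplicative (ZMod p × ZMod (p ^ (k + 2))) :=
  MonoidHom.mk' (fun m => Multiplicative.ofAdd ((coords p k ε m).b, (coords p k ε m).c)) (by
    intro x y
    have hx : (coords p k ε x).a = 0 := (mem_M_iff p k ε x).mp x.2
    have hy : (coords p k ε y).a = 0 := (mem_M_iff p k ε y).mp y.2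
    rw [Subgroup.coe_mul, map_mul, NormalForm.mul_def, hx, hy]
    simp only [NormalForm.tri_zero, zero_mul, mul_zero, map_zero, add_zero]
    rfl)

/-- The character `θ` of `M` with `θ(B) = exp(2πi/p)` and `θ(C) = 1`. -/
def charB : M p (k + 4) ε →* Circle :=
  ((ZMod.toCircle (N := p)).toMonoidHom.comp
    (AddMonoidHom.toMultiplicative (AddMonoidHom.fst _ _))).comp (coordsM p k ε)

/-- The character `ψ` of `M` with `ψ(B) = 1` and `ψ(C) = exp(2πi/p^(n-2))`. -/
def charC : M p (k + 4) ε →* Circle :=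
  ((ZMod.toCircle (N := p ^ (k + 2))).toMonoidHom.comp
    (AddMonoidHom.toMultiplicative (AddMonoidHom.snd _ _))).comp (coordsM p k ε)

theorem charB_apply (m : M p (k + 4) ε) :
    charB p k ε m = ZMod.toCircle (coords p k ε m).b := rfl

theorem charC_apply (m : M p (k + 4) ε) :
    charC p k ε m = ZMod.toCircle (coords p k ε m).c := rfl

theorem charB_B : charB p k ε ⟨B p (k + 4) ε, B_mem _ _ _⟩ = Circle.exp (2 * Real.pi / p) := by
  rw [charB_apply, coords_B, ZMod.toCircle_eq_circleExp]
  have : Fact (1 < p) := ⟨hp.out.one_lt⟩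
  rw [ZMod.val_one]
  congr 1
  push_cast
  ring

theorem charB_C : charB p k ε ⟨C p (k + 4) ε, C_mem _ _ _⟩ = 1 := by
  rw [charB_apply, coords_C, AddChar.map_zero_eq_one]

/-- The restriction of `θ` to `⟨B⟩`. -/
def charCycB : cycB p (k + 4) ε →* Circle :=
  (charB p k ε).comp (Subgroup.inclusion (cycB_le p (k + 4) ε))

theorem resMB_c₁ : resMB p (k + 4) ε (c₁ (charB p k ε)) = c₁ (charCycB p k ε) :=
  HGrp.map_c₁ _ _

theorem charCycB_zpow_apply (j : ℤ) :
    (charCycB p k ε ^ j) ⟨B p (k + 4) ε, Subgroup.mem_zpowers _⟩ = ZMod.toCircle (j : ZMod p) := by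
  change (charB p k ε ⟨B p (k + 4) ε, B_mem _ _ _⟩) ^ j = _
  rw [charB_apply, coords_B, ← AddChar.map_zsmul_eq_zpow, zsmul_one]

theorem natCast_smul_c₁ : (p : ℤ) • c₁ (charCycB p k ε) = 0 := by
  have h : charCycB p k ε ^ (p : ℤ) = charCycB p k ε ^ (0 : ℤ) := by
    refine cycB_hom_ext ?_
    rw [charCycB_zpow_apply, charCycB_zpow_apply]
    simp
  rw [← c₁_zpow, h, c₁_zpow, zero_smul]

/-- Conjugation by `A^i`, from `⟨B⟩` to `M`. -/
def conjA (i : ℤ) : cycB p (k + 4) ε →* M p (k + 4) ε :=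
  ((MulAut.conj (A p (k + 4) ε ^ i)).toMonoidHom.comp (cycB p (k + 4) ε).subtype).codRestrict
    (M p (k + 4) ε) (by
      rintro ⟨_, j, rfl⟩
      refine (mem_M_iff p k ε _).mpr ?_
      change degA p k ε (A p (k + 4) ε ^ i * B p (k + 4) ε ^ j * (A p (k + 4) ε ^ i)⁻¹) = 1
      rw [map_mul, map_mul, map_zpow _ (B p (k + 4) ε), degA_B, one_zpow, mul_one, map_inv,
        mul_inv_cancel])

theorem coords_conjA (i : ℤ) :
    coords p k ε (conjA p k ε i ⟨B p (k + 4) ε, Subgroup.mem_zpowers _⟩) =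
      ⟨0, 1, embed p k ((-ε * i : ℤ) : ZMod p)⟩ := by
  change coords p k ε (A p (k + 4) ε ^ i * B p (k + 4) ε * (A p (k + 4) ε ^ i)⁻¹) = _
  rw [map_mul, map_mul, map_inv, map_zpow, coords_A, coords_B, NormalForm.mk_a_zpow,
    mul_inv_eq_iff_eq_mul, NormalForm.mk_mul_mk, NormalForm.mul_def]
  simp only [reduce_embed, mul_zero, mul_one, add_zero, zero_add, ← map_add]
  push_cast
  simp

theorem charB_comp_conjA (i : ℤ) : (charB p k ε).comp (conjA p k ε i) = charCycB p k ε := by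
  refine cycB_hom_ext ?_
  rw [← zpow_one (charCycB p k ε), charCycB_zpow_apply, MonoidHom.comp_apply, charB_apply,
    coords_conjA, Int.cast_one]

theorem charC_comp_conjA (i : ℤ) :
    (charC p k ε).comp (conjA p k ε i) = charCycB p k ε ^ (-ε * i) := by
  refine cycB_hom_ext ?_
  rw [charCycB_zpow_apply, MonoidHom.comp_apply, charC_apply, coords_conjA, toCircle_embed]

/-- The transfer of `c₁(ψ)^(p-1) c₁(θ)^2` restricts to `-β'^(p+1)`, because the restrictions to `⟨B⟩`
of the conjugates of `c₁(ψ)` are all the multiples of `β'`. -/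
theorem c₁_pow_mem_map_even (hε : (ε : ZMod p) ≠ 0) :
    c₁ (charCycB p k ε) ^ (p + 1) ∈ (Heven (GG p (k + 4) ε)).map (res (cycB p (k + 4) ε)) := by
  have hx : c₁ (charC p k ε) ^ (p - 1) * c₁ (charB p k ε) ^ 2 ∈ Heven (M p (k + 4) ε) :=
    mul_mem (pow_mem (c₁_mem_even _) _) (pow_mem (c₁_mem_even _) _)
  obtain ⟨y, hy, h⟩ := exists_even_map_eq_sum (φ := degA p k ε)
    (σ := fun q => A p (k + 4) ε ^ (q.toAdd.val : ℤ)) (fun q => by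
      rw [map_zpow, degA_A, ← ofAdd_zsmul, zsmul_one, Int.cast_natCast, ZMod.natCast_zmod_val,
        ofAdd_toAdd])
    (fun g hg => (mem_M_iff p k ε g).mpr hg) (cycB p (k + 4) ε).subtype
    (by
      rintro ⟨_, j, rfl⟩
      change degA p k ε (B p (k + 4) ε ^ j) = 1
      rw [map_zpow, degA_B, one_zpow])
    (fun q => conjA p k ε (q.toAdd.val : ℤ)) (fun _ _ => rfl) hx
  refine ⟨-y, neg_mem hy, ?_⟩
  have h2 : res (cycB p (k + 4) ε) y = -(c₁ (charCycB p k ε) ^ (p + 1)) := by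
    refine h.trans ?_
    simp only [map_mul, map_pow, HGrp.map_c₁, charB_comp_conjA, charC_comp_conjA, c₁_zpow,
      smul_pow, smul_mul_assoc, ← pow_add]
    rw [← Finset.sum_smul, show p - 1 + 2 = p + 1 by have := hp.out.two_le; omega]
    have h3 := sum_pow_eq_neg_one p ε hε
    rw [← sub_eq_zero, sub_neg_eq_add, ← Int.cast_one, ← Int.cast_add,
      ZMod.intCast_zmod_eq_zero_iff_dvd] at h3
    obtain ⟨t, ht⟩ := h3
    rw [eq_sub_of_add_eq ht, sub_smul, one_smul, mul_comm, mul_smul, pow_succ', ← smul_mul_assoc,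
      natCast_smul_c₁, zero_mul, smul_zero, zero_sub]
  rw [map_neg, h2, neg_neg]

end Characters

end GG

/-! ### Joint eigenspaces of two commuting unitary operators of order `p` -/

section Eigenspaces

variable {p : ℕ} [hp : Fact p.Prime] {V : Type} [AddCommGroup V] [Module ℂ V]

/-- The `p`-th root of unity `exp(2πi k/p)`. -/
def rootOfUnity (k : ZMod p) : ℂ := ZMod.stdAddChar k

theorem rootOfUnity_add (k l : ZMod p) :
    rootOfUnity (k + l) = rootOfUnity k * rootOfUnity l := AddChar.map_add_eq_mul _ _ _

theorem rootOfUnity_zero : rootOfUnity (0 : ZMod p) = 1 := AddChar.map_zero_eq_one _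

theorem rootOfUnity_ne_zero (k : ZMod p) : rootOfUnity k ≠ 0 := by
  intro h
  have h2 := rootOfUnity_add k (-k)
  rw [h, zero_mul, add_neg_cancel, rootOfUnity_zero] at h2
  exact one_ne_zero h2

theorem rootOfUnity_pow (k : ZMod p) (n : ℕ) : rootOfUnity k ^ n = rootOfUnity ((n : ZMod p) * k) := by
  rw [← nsmul_eq_mul]
  exact (AddChar.map_nsmul_eq_pow _ _ _).symm

theorem rootOfUnity_injective : Function.Injective (rootOfUnity : ZMod p → ℂ) :=
  ZMod.injective_stdAddChar

theorem star_rootOfUnity_mul_self (k : ZMod p) : star (rootOfUnity k) * rootOfUnity k = 1 := by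
  rw [rootOfUnity, ZMod.stdAddChar_apply, Complex.star_def, ← Circle.coe_inv_eq_conj,
    Circle.coe_inv, inv_mul_cancel₀ (Circle.coe_ne_zero _)]

/-- The projection to the eigenspace for `exp(2πi k/p)` of an operator `T` with `T ^ p = 1`. -/
def eigenProj (T : Module.End ℂ V) (k : ZMod p) : Module.End ℂ V :=
  (p : ℂ)⁻¹ • ∑ j : ZMod p, rootOfUnity (-(j * k)) • T ^ j.val

theorem commute_eigenProj {S T : Module.End ℂ V} (h : Commute S T) (k : ZMod p) :
    Commute S (eigenProj T k) :=
  (Commute.sum_right _ _ _ fun _ _ => (h.pow_right _).smul_right _).smul_right _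

theorem mul_eigenProj {T : Module.End ℂ V} (hT : T ^ p = 1) (k : ZMod p) :
    T * eigenProj T k = rootOfUnity k • eigenProj T k := by
  rw [eigenProj, mul_smul_comm, smul_comm]
  congr 1
  rw [Finset.mul_sum, Finset.smul_sum]
  refine Fintype.sum_equiv (Equiv.addRight (1 : ZMod p)) _ _ fun j => ?_
  have h : T ^ (j + 1).val = T * T ^ j.val := by
    have : Fact (1 < p) := ⟨hp.out.one_lt⟩
    rw [← pow_succ', ZMod.val_add, ZMod.val_one, ← pow_mod_orderOf,
      ← pow_mod_orderOf T (j.val + 1), Nat.mod_mod_of_dvd _ (orderOf_dvd_of_pow_eq_one hT)]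
  rw [Equiv.coe_addRight, h, mul_smul_comm, smul_smul, ← rootOfUnity_add]
  congr 2
  ring

theorem sum_eigenProj (T : Module.End ℂ V) : ∑ k : ZMod p, eigenProj T k = 1 := by
  simp only [eigenProj]
  rw [← Finset.smul_sum, Finset.sum_comm]
  have h : ∀ j : ZMod p, ∑ k : ZMod p, rootOfUnity (-(j * k)) • T ^ j.val =
      if j = 0 then (p : ℂ) • 1 else 0 := by
    intro j
    have h2 := AddChar.sum_mulShift (-j) (ZMod.isPrimitive_stdAddChar p)
    rw [← Finset.sum_smul]
    have h3 : ∑ k : ZMod p, rootOfUnity (-(j * k)) =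
        ((if -j = 0 then Fintype.card (ZMod p) else 0 : ℕ) : ℂ) := by
      rw [← h2]
      refine Finset.sum_congr rfl fun k _ => ?_
      rw [rootOfUnity]
      congr 1
      ring
    rw [h3]
    by_cases hj : j = 0
    · subst hj
      rw [if_pos neg_zero, if_pos rfl, ZMod.card, ZMod.val_zero, pow_zero]
    · rw [if_neg (neg_ne_zero.mpr hj), if_neg hj, Nat.cast_zero, zero_smul]
  rw [Finset.sum_congr rfl fun j _ => h j, Finset.sum_ite_eq' Finset.univ, if_pos (Finset.mem_univ _),
    inv_smul_smul₀ (by exact_mod_cast hp.out.ne_zero)]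

/-- The joint eigenspace of `S` and `T` for the eigenvalues `exp(2πi k/p)` and `exp(2πi l/p)`,
where `x = (k, l)`. -/
def jointEigenspace (S T : Module.End ℂ V) (x : ZMod p × ZMod p) : Submodule ℂ V :=
  Module.End.eigenspace S (rootOfUnity x.1) ⊓ Module.End.eigenspace T (rootOfUnity x.2)

theorem mem_jointEigenspace {S T : Module.End ℂ V} {x : ZMod p × ZMod p} {v : V} :
    v ∈ jointEigenspace S T x ↔ S v = rootOfUnity x.1 • v ∧ T v = rootOfUnity x.2 • v := by
  rw [jointEigenspace, Submodule.mem_inf, Module.End.mem_eigenspace_iff,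
    Module.End.mem_eigenspace_iff]

theorem iSup_jointEigenspace {S T : Module.End ℂ V} (h : Commute S T) (hS : S ^ p = 1)
    (hT : T ^ p = 1) : ⨆ x : ZMod p × ZMod p, jointEigenspace S T x = ⊤ := by
  rw [eq_top_iff]
  intro v _
  have hv : v = ∑ k : ZMod p, ∑ l : ZMod p, eigenProj T l (eigenProj S k v) := by
    have h1 : ∀ w : V, ∑ l : ZMod p, eigenProj T l w = w := fun w => by
      rw [← LinearMap.sum_apply, sum_eigenProj, Module.End.one_apply]
    rw [Finset.sum_congr rfl fun k _ => h1 _, ← LinearMap.sum_apply, sum_eigenProj,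
      Module.End.one_apply]
  rw [hv]
  refine Submodule.sum_mem _ fun k _ => Submodule.sum_mem _ fun l _ => ?_
  refine Submodule.mem_iSup_of_mem (k, l) (mem_jointEigenspace.mpr ⟨?_, ?_⟩)
  · rw [← Module.End.mul_apply S, (commute_eigenProj h l).eq, Module.End.mul_apply,
      ← Module.End.mul_apply S, mul_eigenProj hS, LinearMap.smul_apply, map_smul]
  · rw [← Module.End.mul_apply T, mul_eigenProj hT, LinearMap.smul_apply]

end Eigenspaces

section Orthogonality

variable {p : ℕ} [hp : Fact p.Prime] {V : Type} [NormedAddCommGroup V] [InnerProductSpace ℂ V]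

theorem inner_eq_zero_of_eigenvector {S : Module.End ℂ V}
    (hS : ∀ v w, inner ℂ (S v) (S w) = inner ℂ v w) {k k' : ZMod p} (hk : k ≠ k') {v w : V}
    (hv : S v = rootOfUnity k • v) (hw : S w = rootOfUnity k' • w) : inner ℂ v w = 0 := by
  have h := hS v w
  rw [hv, hw, inner_smul_left, inner_smul_right, ← mul_assoc] at h
  by_contra h0
  have h2 := mul_right_cancel₀ h0 (h.trans (one_mul _).symm)
  rw [← star_rootOfUnity_mul_self k] at h2
  refine hk (rootOfUnity_injective (mul_left_cancel₀ ?_ h2)).symm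
  exact star_ne_zero.mpr (rootOfUnity_ne_zero k)

theorem orthogonalFamily_jointEigenspace {S T : Module.End ℂ V}
    (hS : ∀ v w, inner ℂ (S v) (S w) = inner ℂ v w)
    (hT : ∀ v w, inner ℂ (T v) (T w) = inner ℂ v w) :
    OrthogonalFamily ℂ (fun x : ZMod p × ZMod p => jointEigenspace S T x)
      fun x => (jointEigenspace S T x).subtypeₗᵢ := by
  rintro x y hxy ⟨v, hv⟩ ⟨w, hw⟩
  rw [mem_jointEigenspace] at hv hw
  change inner ℂ v w = 0
  by_cases h : x.1 = y.1
  · exact inner_eq_zero_of_eigenvector hT (fun h2 => hxy (Prod.ext h h2)) hv.2 hw.2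
  · exact inner_eq_zero_of_eigenvector hS h hv.1 hw.1

/-- Two commuting unitary operators of order `p` have an orthonormal basis of joint eigenvectors, in
which each joint eigenspace has as many members as its dimension says. -/
theorem exists_orthonormalBasis_joint [FiniteDimensional ℂ V] {n : ℕ}
    (hn : Module.finrank ℂ V = n) {S T : Module.End ℂ V} (h : Commute S T) (hSp : S ^ p = 1)
    (hTp : T ^ p = 1) (hS : ∀ v w, inner ℂ (S v) (S w) = inner ℂ v w)
    (hT : ∀ v w, inner ℂ (T v) (T w) = inner ℂ v w) :
    ∃ (v : OrthonormalBasis (Fin n) ℂ V) (x : Fin n → ZMod p × ZMod p),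
      (∀ j, v j ∈ jointEigenspace S T (x j)) ∧
      ∀ y, Finset.card {j | x j = y} = Module.finrank ℂ (jointEigenspace S T y) := by
  have horth := orthogonalFamily_jointEigenspace (p := p) hS hT
  have hint : DirectSum.IsInternal fun x : ZMod p × ZMod p => jointEigenspace S T x :=
    DirectSum.isInternal_submodule_iff_iSupIndep_and_iSup_eq_top _ |>.mpr
      ⟨horth.independent, iSup_jointEigenspace h hSp hTp⟩
  exact ⟨hint.subordinateOrthonormalBasis hn horth,
    fun j => hint.subordinateOrthonormalBasisIndex hn j horth,
    fun j => hint.subordinateOrthonormalBasis_subordinate hn j horth,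
    fun y => hint.card_filter_subordinateOrthonormalBasisIndex_eq hn horth y⟩

end Orthogonality

/-! ### Multiplicities of the eigenvalues of `B` -/

namespace GG

theorem Z_pow {p k : ℕ} {ε : ℤ} : Z p k ε ^ p = 1 := by
  rw [Z, ← pow_mul, ← pow_succ, C_pow]

theorem commute_A_Z {p k : ℕ} {ε : ℤ} : Commute (A p (k + 4) ε) (Z p k ε) := by
  have h := C_zpow_mul_A (p := p) (k := k) (ε := ε) ((p ^ (k + 1) : ℕ) : ℤ)
  rw [zpow_natCast, zpow_natCast, pow_succ' p k, pow_mul (B p (k + 4) ε), B_pow, one_pow,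
    one_mul, ← pow_succ' p k] at h
  exact h.symm

theorem injective_of_hom {G V : Type} [Group G] [AddCommGroup V] [Module ℂ V]
    (ρ : G →* Module.End ℂ V) (g : G) :
    Function.Injective (ρ g) := by
  intro v w h
  have e : ∀ v, ρ g⁻¹ (ρ g v) = v := fun v => by
    rw [← Module.End.mul_apply, ← map_mul, inv_mul_cancel, map_one, Module.End.one_apply]
  rw [← e v, h, e w]

section Multiplicity

variable {p k : ℕ} {ε : ℤ} [hp : Fact p.Prime] {V : Type} [AddCommGroup V] [Module ℂ V]
  (ρ : GG p (k + 4) ε →* Module.End ℂ V)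

/-- `A` maps the joint eigenspace `(i, l)` of `B` and `Z` to the joint eigenspace `(i + ε l, l)`. -/
theorem map_A_mem {i l : ZMod p} {v : V}
    (hv : v ∈ jointEigenspace (ρ (B p (k + 4) ε)) (ρ (Z p k ε)) (i, l)) :
    ρ (A p (k + 4) ε) v ∈
      jointEigenspace (ρ (B p (k + 4) ε)) (ρ (Z p k ε)) (i + (ε : ZMod p) * l, l) := by
  rw [mem_jointEigenspace] at hv ⊢
  dsimp only at hv ⊢
  have hpow : ∀ m : ℕ, ρ (Z p k ε ^ m) v = rootOfUnity ((m : ZMod p) * l) • v := by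
    intro m
    rw [map_pow, ← rootOfUnity_pow]
    induction m with
    | zero => simp
    | succ m ih =>
      rw [pow_succ', Module.End.mul_apply, ih, map_smul, hv.2, smul_smul, pow_succ]
  have hZε : Z p k ε ^ ε = Z p k ε ^ (ε : ZMod p).val := by
    rw [← zpow_natCast, ← mul_inv_eq_one, ← zpow_neg, ← zpow_add]
    refine zpow_eq_one_of_cast Z_pow ?_
    push_cast
    rw [ZMod.natCast_zmod_val, add_neg_cancel]
  constructor
  · rw [← Module.End.mul_apply, ← map_mul, B_mul_A, map_mul, map_mul, Module.End.mul_apply,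
      Module.End.mul_apply, hZε, hpow, ZMod.natCast_zmod_val, map_smul, hv.1, smul_smul, map_smul,
      rootOfUnity_add, mul_comm]
  · rw [← Module.End.mul_apply, ← map_mul, ← commute_A_Z.eq, map_mul, Module.End.mul_apply, hv.2,
      map_smul]

variable [FiniteDimensional ℂ V]

theorem finrank_le_shift (i l : ZMod p) :
    Module.finrank ℂ (jointEigenspace (ρ (B p (k + 4) ε)) (ρ (Z p k ε)) (i, l)) ≤
      Module.finrank ℂ
        (jointEigenspace (ρ (B p (k + 4) ε)) (ρ (Z p k ε)) (i + (ε : ZMod p) * l, l)) :=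
  LinearMap.finrank_le_finrank_of_injective
    (f := (ρ (A p (k + 4) ε)).restrict fun _ hv => map_A_mem ρ hv) fun _ _ h =>
      Subtype.ext (injective_of_hom ρ _ (congrArg Subtype.val h))

theorem finrank_eq_of_ne_zero (hε : (ε : ZMod p) ≠ 0) {l : ZMod p} (hl : l ≠ 0) (i i' : ZMod p) :
    Module.finrank ℂ (jointEigenspace (ρ (B p (k + 4) ε)) (ρ (Z p k ε)) (i, l)) =
      Module.finrank ℂ (jointEigenspace (ρ (B p (k + 4) ε)) (ρ (Z p k ε)) (i', l)) := by
  have step : ∀ (i : ZMod p) (m : ℕ),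
      Module.finrank ℂ (jointEigenspace (ρ (B p (k + 4) ε)) (ρ (Z p k ε)) (i, l)) ≤
      Module.finrank ℂ (jointEigenspace (ρ (B p (k + 4) ε)) (ρ (Z p k ε))
        (i + (m : ZMod p) * ((ε : ZMod p) * l), l)) := by
    intro i m
    induction m with
    | zero => rw [Nat.cast_zero, zero_mul, add_zero]
    | succ m ih =>
      refine ih.trans ((finrank_le_shift ρ _ _).trans_eq ?_)
      rw [show i + (m : ZMod p) * ((ε : ZMod p) * l) + (ε : ZMod p) * l =
        i + ((m + 1 : ℕ) : ZMod p) * ((ε : ZMod p) * l) by push_cast; ring]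
  have le : ∀ i i' : ZMod p,
      Module.finrank ℂ (jointEigenspace (ρ (B p (k + 4) ε)) (ρ (Z p k ε)) (i, l)) ≤
      Module.finrank ℂ (jointEigenspace (ρ (B p (k + 4) ε)) (ρ (Z p k ε)) (i', l)) := by
    intro i i'
    have h := step i ((i' - i) / ((ε : ZMod p) * l)).val
    rwa [ZMod.natCast_zmod_val, div_mul_cancel₀ _ (mul_ne_zero hε hl), add_sub_cancel] at h
  exact le_antisymm (le i i') (le i' i)

/-- On the joint eigenspace `(i, 0)` the commutator `B` of `A` and `C⁻¹` is a scalar, and comparing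
determinants shows that its power with exponent the dimension is `1`. -/
theorem finrank_eq_zero_of_ne_zero {i : ZMod p} (hi : i ≠ 0) :
    (Module.finrank ℂ (jointEigenspace (ρ (B p (k + 4) ε)) (ρ (Z p k ε)) (i, 0)) : ZMod p) = 0 := by
  set W := jointEigenspace (ρ (B p (k + 4) ε)) (ρ (Z p k ε)) (i, 0) with hW
  have hA : ∀ v ∈ W, ρ (A p (k + 4) ε) v ∈ W := by
    intro v hv
    have h := map_A_mem ρ hv
    rwa [mul_zero, add_zero] at h
  have hC : ∀ v ∈ W, ρ (C p (k + 4) ε) v ∈ W := by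
    intro v hv
    rw [hW, mem_jointEigenspace] at hv ⊢
    constructor
    · rw [← Module.End.mul_apply, ← map_mul, commute_B_C.eq, map_mul, Module.End.mul_apply, hv.1,
        map_smul]
    · rw [← Module.End.mul_apply, ← map_mul, ← commute_C_Z.eq, map_mul, Module.End.mul_apply, hv.2,
        map_smul]
  let a : Module.End ℂ W := (ρ (A p (k + 4) ε)).restrict hA
  let c : Module.End ℂ W := (ρ (C p (k + 4) ε)).restrict hC
  have hca : c * a = rootOfUnity i • (a * c) := by
    refine LinearMap.ext fun v => Subtype.ext ?_
    change ρ (C p (k + 4) ε) (ρ (A p (k + 4) ε) v) =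
      rootOfUnity i • ρ (A p (k + 4) ε) (ρ (C p (k + 4) ε) v)
    have h := (mem_jointEigenspace.mp (hC v v.2)).1
    rw [← Module.End.mul_apply, ← map_mul, C_mul_A, map_mul, map_mul, Module.End.mul_apply,
      Module.End.mul_apply, h, map_smul]
  have hdet : ∀ (g : GG p (k + 4) ε) (hg : ∀ v ∈ W, ρ g v ∈ W),
      LinearMap.det ((ρ g).restrict hg) ≠ 0 := by
    intro g hg
    have hinj : Function.Injective ((ρ g).restrict hg) := fun v w h =>
      Subtype.ext (injective_of_hom ρ g (congrArg Subtype.val h))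
    exact (LinearMap.isUnit_iff_isUnit_det _).mp
      ((LinearMap.isUnit_iff_ker_eq_bot _).mpr (LinearMap.ker_eq_bot.mpr hinj)) |>.ne_zero
  have h := congrArg LinearMap.det hca
  rw [LinearMap.det_smul, map_mul, map_mul, mul_comm (LinearMap.det a)] at h
  have h2 := mul_right_cancel₀ (mul_ne_zero (hdet _ hC) (hdet _ hA)) ((one_mul _).trans h)
  rw [rootOfUnity_pow, ← rootOfUnity_zero (p := p)] at h2
  exact (mul_eq_zero.mp (rootOfUnity_injective h2).symm).resolve_right hi

end Multiplicity

end GG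

/-! ### Total Chern classes in `𝔽_p⟦X⟧` -/

/-- The elementary symmetric polynomials in the `x j X` are the homogeneous components of the product
of the `1 + x j X`. -/
theorem elemSymm_eq_coeff_prod {p n : ℕ} (x : Fin n → ZMod p) (i : ℕ) :
    elemSymm i (fun j => PowerSeries.C (x j) * PowerSeries.X) =
      PowerSeries.C (PowerSeries.coeff i (∏ j, (1 + PowerSeries.C (x j) * PowerSeries.X))) *
        PowerSeries.X ^ i := by
  have h1 : ∀ s : Finset (Fin n), ∏ j ∈ s, (PowerSeries.C (x j) * PowerSeries.X) =
      PowerSeries.C (∏ j ∈ s, x j) * PowerSeries.X ^ s.card := by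
    intro s
    rw [Finset.prod_mul_distrib, Finset.prod_const, map_prod]
  have h2 : PowerSeries.coeff i (∏ j, (1 + PowerSeries.C (x j) * PowerSeries.X)) =
      ∑ s ∈ Finset.powersetCard i Finset.univ, ∏ j ∈ s, x j := by
    rw [Finset.prod_one_add, map_sum, Finset.powersetCard_eq_filter,
      Finset.sum_filter]
    refine Finset.sum_congr (by simp) fun s _ => ?_
    rw [h1, PowerSeries.coeff_C_mul, PowerSeries.coeff_X_pow]
    simp only [eq_comm (a := i), mul_ite, mul_one, mul_zero]
  rw [h2, elemSymm_eq, map_sum, Finset.sum_mul]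
  refine Finset.sum_congr rfl fun s hs => ?_
  rw [h1, (Finset.mem_powersetCard.mp hs).2]

section GapSubring

variable {p : ℕ} [hp : Fact p.Prime] [hp5 : Fact (5 ≤ p)]

/-- The power series without terms of degree `1, …, p - 2` and `p + 1`. These degrees are not of the
form `a (p - 1) + b p`, and the conditions are stable under multiplication for `p ≥ 5`. -/
def gapSubring (p : ℕ) [Fact p.Prime] [hp5 : Fact (5 ≤ p)] : Subring (PowerSeries (ZMod p)) where
  carrier := {f | ∀ m, (1 ≤ m ∧ m ≤ p - 2) ∨ m = p + 1 → PowerSeries.coeff m f = 0}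
  zero_mem' m _ := by rw [map_zero]
  one_mem' m hm := by
    rw [PowerSeries.coeff_one, if_neg (by omega)]
  add_mem' hf hg m hm := by rw [map_add, hf m hm, hg m hm, add_zero]
  neg_mem' hf m hm := by rw [map_neg, hf m hm, neg_zero]
  mul_mem' {f g} hf hg m hm := by
    have := hp5.out
    rw [PowerSeries.coeff_mul]
    refine Finset.sum_eq_zero ?_
    rintro ⟨a, b⟩ h
    rw [Finset.HasAntidiagonal.mem_antidiagonal] at h
    dsimp only at h ⊢
    -- one of the two degrees is excluded, since `2 (p - 1) > p + 1`
    by_cases ha : (1 ≤ a ∧ a ≤ p - 2) ∨ a = p + 1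
    · rw [hf a ha, zero_mul]
    · rw [hg b (by omega), mul_zero]

theorem mem_gapSubring {f : PowerSeries (ZMod p)} : f ∈ gapSubring p ↔
    ∀ m, (1 ≤ m ∧ m ≤ p - 2) ∨ m = p + 1 → PowerSeries.coeff m f = 0 := Iff.rfl

theorem X_pow_notMem_gapSubring : (PowerSeries.X : PowerSeries (ZMod p)) ^ (p + 1) ∉ gapSubring p := by
  intro h
  have := mem_gapSubring.mp h (p + 1) (Or.inr rfl)
  rw [PowerSeries.coeff_X_pow_self] at this
  exact one_ne_zero this

/-- The product of all `1 + k X` is invariant under `X ↦ u X` for every unit `u`, so only degrees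
divisible by `p - 1` occur in it. -/
theorem prod_one_add_mem_gapSubring :
    ∏ i : ZMod p, (1 + PowerSeries.C i * PowerSeries.X) ∈ gapSubring p := by
  intro m hm
  obtain ⟨u, hu⟩ := IsCyclic.exists_generator (α := (ZMod p)ˣ)
  set f : PowerSeries (ZMod p) := ∏ i : ZMod p, (1 + PowerSeries.C i * PowerSeries.X) with hf
  have hinv : PowerSeries.rescale (u : ZMod p) f = f := by
    rw [hf, map_prod]
    refine Fintype.prod_equiv (Units.mulRight u) _ _ fun i => ?_
    rw [map_add, map_one, map_mul, PowerSeries.rescale_X, ← mul_assoc, Units.mulRight_apply, map_mul]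
    congr 3
    ext n
    rw [PowerSeries.coeff_rescale, PowerSeries.coeff_C]
    split_ifs with h
    · rw [h, pow_zero, one_mul]
    · rw [mul_zero]
  have h := congrArg (PowerSeries.coeff m) hinv
  rw [PowerSeries.coeff_rescale] at h
  by_contra hne
  have h2 : (u : ZMod p) ^ m = 1 := mul_right_cancel₀ hne (h.trans (one_mul _).symm)
  have h3 : u ^ m = 1 := Units.ext (by rw [Units.val_pow_eq_pow_val, h2, Units.val_one])
  have h4 : p - 1 ∣ m := by
    have := orderOf_dvd_of_pow_eq_one h3
    rwa [orderOf_eq_card_of_forall_mem_zpowers hu, Nat.card_eq_fintype_card,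
      ZMod.card_units] at this
  have := hp5.out
  obtain ⟨t, rfl⟩ := h4
  rcases hm with hm | hm
  · have := Nat.le_mul_of_pos_right (p - 1) (Nat.pos_of_ne_zero (n := t) (by rintro rfl; simp at hm))
    omega
  · have h5 : p - 1 ∣ 2 := by
      have : (p - 1) * t - (p - 1) = 2 := by omega
      rw [← this]
      exact Nat.dvd_sub (dvd_mul_right _ _) dvd_rfl
    have := Nat.le_of_dvd (by omega) h5
    omega

theorem one_add_pow_mem_gapSubring (i : ZMod p) :
    (1 + PowerSeries.C i * PowerSeries.X) ^ p ∈ gapSubring p := by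
  have : CharP (PowerSeries (ZMod p)) p :=
    charP_of_injective_ringHom (f := PowerSeries.C) PowerSeries.C_injective p
  rw [add_pow_char, one_pow, mul_pow, ← map_pow]
  refine add_mem (one_mem _) fun m hm => ?_
  rw [PowerSeries.coeff_C_mul, PowerSeries.coeff_X_pow, if_neg (by omega), mul_zero]

/-- If all non-zero elements occur equally often modulo `p` among the `x j`, then the elementary
symmetric polynomials in the `x j X` have no term in the excluded degrees. -/
theorem elemSymm_mem_gapSubring {n : ℕ} (x : Fin n → ZMod p)
    (hx : ∀ i i' : ZMod p, i ≠ 0 → i' ≠ 0 → ((Finset.card {j | x j = i} : ℕ) : ZMod p) =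
      (Finset.card {j | x j = i'} : ℕ)) (i : ℕ) :
    elemSymm i (fun j => PowerSeries.C (x j) * PowerSeries.X) ∈ gapSubring p := by
  have hprod : ∏ j, (1 + PowerSeries.C (x j) * PowerSeries.X) ∈ gapSubring p := by
    let m : ZMod p → ℕ := fun i => Finset.card {j | x j = i}
    have h1 : ∏ j, (1 + PowerSeries.C (x j) * PowerSeries.X) =
        ∏ i : ZMod p, (1 + PowerSeries.C i * PowerSeries.X) ^ m i := by
      rw [← Finset.prod_fiberwise' Finset.univ x
        fun i => (1 + PowerSeries.C i * PowerSeries.X : PowerSeries (ZMod p))]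
      exact Finset.prod_congr rfl fun i _ => Finset.prod_const _
    have h2 : ∀ i : ZMod p, (1 + PowerSeries.C i * PowerSeries.X : PowerSeries (ZMod p)) ^ m i =
        (1 + PowerSeries.C i * PowerSeries.X) ^ (m 1 % p) *
          ((1 + PowerSeries.C i * PowerSeries.X) ^ p) ^ (m i / p) := by
      intro i
      by_cases hi : i = 0
      · rw [hi, map_zero, zero_mul, add_zero]
        simp
      · have h3 : m 1 % p = m i % p := (ZMod.natCast_eq_natCast_iff' _ _ _).mp (hx 1 i one_ne_zero hi)
        rw [h3, ← pow_mul, ← pow_add, Nat.mod_add_div]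
    rw [h1, Finset.prod_congr rfl fun i _ => h2 i, Finset.prod_mul_distrib, Finset.prod_pow]
    exact mul_mem (pow_mem prod_one_add_mem_gapSubring _)
      (prod_mem fun i _ => pow_mem (one_add_pow_mem_gapSubring i) _)
  rw [elemSymm_eq_coeff_prod]
  intro m hm
  rw [PowerSeries.coeff_C_mul, PowerSeries.coeff_X_pow]
  split_ifs with h
  · rw [← h, hprod m hm, zero_mul]
  · rw [mul_zero]

end GapSubring

/-! ### Diagonalization of the restriction to `⟨B⟩` -/

section Diagonalization

/-- The operators on Euclidean space given by unitary matrices. -/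
def unitaryAction (n : ℕ) :
    Matrix.unitaryGroup (Fin n) ℂ →* Module.End ℂ (EuclideanSpace ℂ (Fin n)) where
  toFun U := (Matrix.toEuclideanCLM (𝕜 := ℂ) U.1).toLinearMap
  map_one' := congrArg ContinuousLinearMap.toLinearMap (map_one (Matrix.toEuclideanCLM (𝕜 := ℂ)))
  map_mul' U W :=
    congrArg ContinuousLinearMap.toLinearMap (map_mul (Matrix.toEuclideanCLM (𝕜 := ℂ)) U.1 W.1)

theorem unitaryAction_apply {n : ℕ} (U : Matrix.unitaryGroup (Fin n) ℂ)
    (v : EuclideanSpace ℂ (Fin n)) (i : Fin n) :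
    unitaryAction n U v i = ∑ l, U.1 i l * v l := rfl

theorem inner_unitaryAction {n : ℕ} (U : Matrix.unitaryGroup (Fin n) ℂ)
    (v w : EuclideanSpace ℂ (Fin n)) :
    inner ℂ (unitaryAction n U v) (unitaryAction n U w) = inner ℂ v w :=
  ContinuousLinearMap.inner_map_map_of_mem_unitary
    (Unitary.map_mem (Matrix.toEuclideanCLM (𝕜 := ℂ)) U.2) v w

variable {p k : ℕ} {ε : ℤ} [hp : Fact p.Prime]

theorem GG.exists_diagonalization (hε : (ε : ZMod p) ≠ 0) {n : ℕ}
    (ρ : GG p (k + 4) ε →* Matrix.unitaryGroup (Fin n) ℂ) :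
    ∃ (t : Matrix.unitaryGroup (Fin n) ℂ) (x : Fin n → ZMod p),
      (diagTorus n fun j => ZMod.toCircle (x j)) = t⁻¹ * ρ (B p (k + 4) ε) * t ∧
      ∀ i i' : ZMod p, i ≠ 0 → i' ≠ 0 → ((Finset.card {j | x j = i} : ℕ) : ZMod p) =
        (Finset.card {j | x j = i'} : ℕ) := by
  let R := (unitaryAction n).comp ρ
  obtain ⟨v, x, hv, hx⟩ := exists_orthonormalBasis_joint (p := p) (n := n)
    (S := R (B p (k + 4) ε)) (T := R (Z p k ε)) finrank_euclideanSpace_fin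
    (commute_B_Z.map R) (by rw [← map_pow, B_pow, map_one]) (by rw [← map_pow, Z_pow, map_one])
    (inner_unitaryAction _) (inner_unitaryAction _)
  let t : Matrix.unitaryGroup (Fin n) ℂ := ⟨(EuclideanSpace.basisFun (Fin n) ℂ).toBasis.toMatrix v,
    (EuclideanSpace.basisFun (Fin n) ℂ).toMatrix_orthonormalBasis_mem_unitary v⟩
  have ht : ∀ i j, t.1 i j = v j i := fun i j => by
    change (EuclideanSpace.basisFun (Fin n) ℂ).toBasis.repr (v j) i = _
    simp
  refine ⟨t, fun j => (x j).1, ?_, ?_⟩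
  · rw [mul_assoc, eq_inv_mul_iff_mul_eq]
    ext i j
    have h1 : (t.1 * Matrix.diagonal fun j => (ZMod.toCircle (x j).1 : ℂ)) i j =
        rootOfUnity (x j).1 * v j i := by
      rw [Matrix.mul_diagonal, ht, mul_comm]
      rfl
    have h2 : ((ρ (B p (k + 4) ε)).1 * t.1) i j = rootOfUnity (x j).1 * v j i := by
      rw [Matrix.mul_apply]
      simp only [ht]
      rw [← unitaryAction_apply]
      have h3 := (mem_jointEigenspace.mp (hv j)).1
      exact congrArg (fun w : EuclideanSpace ℂ (Fin n) => w i) h3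
    exact h1.trans h2.symm
  · have hcard : ∀ i : ZMod p, Finset.card {j | (x j).1 = i} = ∑ l : ZMod p,
        Module.finrank ℂ (jointEigenspace (R (B p (k + 4) ε)) (R (Z p k ε)) (i, l)) := by
      intro i
      rw [Finset.card_eq_sum_card_fiberwise (f := fun j => (x j).2) (t := Finset.univ)
        fun _ _ => Finset.mem_coe.mpr (Finset.mem_univ _)]
      refine Finset.sum_congr rfl fun l _ => ?_
      rw [← hx, Finset.filter_filter]
      congr 1
      ext j
      simp only [Finset.mem_filter, Prod.ext_iff]
    intro i i' hi hi'
    rw [hcard, hcard, Nat.cast_sum, Nat.cast_sum]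
    refine Finset.sum_congr rfl fun l _ => ?_
    by_cases hl : l = 0
    · rw [hl, finrank_eq_zero_of_ne_zero R hi, finrank_eq_zero_of_ne_zero R hi']
    · rw [finrank_eq_of_ne_zero R hε hl i i']

end Diagonalization

/-! ### Restriction of the Chern ring -/

theorem multiplicative_zmod_hom_ext {p : ℕ} [NeZero p] {H : Type} [Group H]
    {f g : Multiplicative (ZMod p) →* H}
    (h : f (Multiplicative.ofAdd 1) = g (Multiplicative.ofAdd 1)) : f = g := by
  refine MonoidHom.ext fun x => ?_
  have hx : x = Multiplicative.ofAdd 1 ^ x.toAdd.val := by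
    rw [← ofAdd_nsmul, nsmul_one, ZMod.natCast_zmod_val, ofAdd_toAdd]
  rw [hx, map_pow, map_pow, h]

namespace GG

section Restriction

variable (p k : ℕ) (ε : ℤ)

/-- The homomorphism `ℤ/p → ⟨B⟩` with `1 ↦ B`. -/
def powB : Multiplicative (ZMod p) →* cycB p (k + 4) ε :=
  AddMonoidHom.toMultiplicativeLeft (ZMod.lift p
    ⟨zmultiplesHom _ (Additive.ofMul ⟨B p (k + 4) ε, Subgroup.mem_zpowers _⟩),
      Additive.toMul.injective (Subtype.ext ((zpow_natCast _ p).trans B_pow))⟩)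

theorem powB_one : powB p k ε (Multiplicative.ofAdd 1) =
    ⟨B p (k + 4) ε, Subgroup.mem_zpowers _⟩ := by
  change Additive.toMul (ZMod.lift p _ (1 : ZMod p)) = _
  rw [← Int.cast_one, ZMod.lift_coe]
  exact Subtype.ext (zpow_one _)

variable [hp : Fact p.Prime] [hp5 : Fact (5 ≤ p)]

/-- The ring homomorphism `H^*(⟨B⟩; ℤ) → 𝔽_p⟦X⟧`. -/
def seriesB : HGrp (cycB p (k + 4) ε) →+* PowerSeries (ZMod p) :=
  series.comp (HGrp.map (powB p k ε))

theorem seriesB_c₁ : seriesB p k ε (c₁ (charCycB p k ε)) = PowerSeries.X := by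
  change series (HGrp.map (powB p k ε) (c₁ (charCycB p k ε))) = _
  rw [HGrp.map_c₁, series_c₁ _ 1, Int.cast_one, map_one, one_mul]
  rw [MonoidHom.comp_apply, powB_one, ← zpow_one (charCycB p k ε), charCycB_zpow_apply,
    Int.cast_one, ZMod.toCircle_eq_circleExp]
  have : Fact (1 < p) := ⟨hp.out.one_lt⟩
  rw [ZMod.val_one, Int.cast_one, Nat.cast_one]

theorem seriesB_mem_gapSubring (hε : (ε : ZMod p) ≠ 0) {y : HGrp (GG p (k + 4) ε)}
    (hy : y ∈ Ch (GG p (k + 4) ε)) : seriesB p k ε (res (cycB p (k + 4) ε) y) ∈ gapSubring p := by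
  have hle : Ch (GG p (k + 4) ε) ≤
      (gapSubring p).comap ((seriesB p k ε).comp (res (cycB p (k + 4) ε))) := by
    refine Subring.closure_le.mpr ?_
    rintro y ⟨n, ρ, i, hy⟩
    obtain ⟨t, x, ht, hx⟩ := exists_diagonalization hε ρ
    let χ : Fin n → Multiplicative (ZMod p) →* Circle := fun j =>
      (ZMod.toCircle (N := p)).toMonoidHom.comp
        (AddMonoidHom.toMultiplicative (AddMonoidHom.mulLeft (x j)))
    have hχ : ∀ j a, χ j (Multiplicative.ofAdd a) = ZMod.toCircle (x j * a) := fun _ _ => rfl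
    let f : Multiplicative (ZMod p) →* GG p (k + 4) ε := (cycB p (k + 4) ε).subtype.comp (powB p k ε)
    have hf : f (Multiplicative.ofAdd 1) = B p (k + 4) ε := congrArg Subtype.val (powB_one p k ε)
    have hhom : (diagTorus n : (Fin n → Circle) →* _).comp (MonoidHom.pi χ) =
        (MulAut.conj t⁻¹).toMonoidHom.comp (ρ.comp f) := by
      refine multiplicative_zmod_hom_ext ?_
      change diagTorus n (fun j => χ j (Multiplicative.ofAdd 1)) =
        t⁻¹ * ρ (f (Multiplicative.ofAdd 1)) * (t⁻¹)⁻¹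
      simp only [hχ, mul_one]
      rw [hf, inv_inv, ht]
    have key := map_chernClass_of_diagonal f ρ t χ (fun g => by
      have := DFunLike.congr_fun hhom g
      change diagTorus n (fun j => χ j g) = t⁻¹ * ρ (f g) * (t⁻¹)⁻¹ at this
      rw [this, inv_inv]) hy
    change series (HGrp.map (powB p k ε) (HGrp.map (cycB p (k + 4) ε).subtype y)) ∈ gapSubring p
    rw [HGrp.map_map, key, map_elemSymm]
    have hs : (series ∘ fun j => c₁ (χ j)) = fun j => PowerSeries.C (x j) * PowerSeries.X := by
      funext j
      change series (c₁ (χ j)) = _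
      rw [series_c₁ (χ j) ((x j).val : ℤ), Int.cast_natCast, ZMod.natCast_zmod_val]
      rw [hχ, mul_one, ZMod.toCircle_eq_circleExp, Int.cast_natCast]
    rw [hs]
    exact elemSymm_mem_gapSubring x hx i
  exact hle hy

end Restriction

end GG

theorem intCast_ne_zero_of_nonresidue {p : ℕ} [hp : Fact p.Prime] {ε : ℤ}
    (hε : ε = 1 ∨ ¬ IsSquare (ε : ZMod p)) : (ε : ZMod p) ≠ 0 := by
  rcases hε with rfl | h
  · rw [Int.cast_one]
    exact one_ne_zero
  · intro h0
    exact h (h0 ▸ IsSquare.zero)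

end ChernRing

end

theorem corollary2 (p n : ℕ) (hp : p.Prime) (hp5 : 5 ≤ p) (hn : 4 ≤ n) (ε : ℤ)
    (hε : ε = 1 ∨ ¬ IsSquare (ε : ZMod p)) :
    -- `G = G(n, ε)` has order `p ^ n` and `p`-rank two
    Nat.card (GG p n ε) = p ^ n ∧
    IsGreatest {r : ℕ | ∃ E : Subgroup (GG p n ε),
      Nonempty (E ≃* Multiplicative (Fin r → ZMod p))} 2 ∧
    -- `Ch(G)` is strictly contained in `H^even(G; ℤ)`
    Ch (GG p n ε) < Heven (GG p n ε) ∧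
    -- `Ch(G)` does not map onto `H^*(G; ℤ)` modulo its nilradical
    ¬ Function.Surjective (fun x : Ch (GG p n ε) =>
      (nilrad (HGrp (GG p n ε))).ringCon.mk' x.1) ∧
    -- the witness `β' ^ (p + 1)`, where `β' = Res c₁(θ)`
    ∃ θ : GG.M p n ε →* Circle,
      θ ⟨GG.B p n ε, GG.B_mem p n ε⟩ = Circle.exp (2 * Real.pi / p) ∧
      θ ⟨GG.C p n ε, GG.C_mem p n ε⟩ = 1 ∧
      GG.resMB p n ε (c₁ θ) ^ (p + 1) ∈ (Heven (GG p n ε)).map (res (GG.cycB p n ε)) ∧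
      GG.resMB p n ε (c₁ θ) ^ (p + 1) ∉ (Ch (GG p n ε)).map (res (GG.cycB p n ε)) ∧
      ¬ IsNilpotent (GG.resMB p n ε (c₁ θ) ^ (p + 1)) := by
  have hpF : Fact p.Prime := ⟨hp⟩
  have hp5F : Fact (5 ≤ p) := ⟨hp5⟩
  obtain ⟨k, rfl⟩ : ∃ k, n = k + 4 := ⟨n - 4, by omega⟩
  have hε0 : (ε : ZMod p) ≠ 0 := intCast_ne_zero_of_nonresidue hε
  have hmem := GG.c₁_pow_mem_map_even p k ε hε0
  have hser : GG.seriesB p k ε (c₁ (GG.charCycB p k ε) ^ (p + 1)) = PowerSeries.X ^ (p + 1) := by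
    rw [map_pow, GG.seriesB_c₁]
  have hnot : ∀ x ∈ Ch (GG p (k + 4) ε), GG.seriesB p k ε (res (GG.cycB p (k + 4) ε) x) ≠
      PowerSeries.X ^ (p + 1) := fun x hx h =>
    X_pow_notMem_gapSubring (h ▸ GG.seriesB_mem_gapSubring p k ε hε0 hx)
  obtain ⟨y, hy, hyB⟩ := hmem
  have hyser : GG.seriesB p k ε (res (GG.cycB p (k + 4) ε) y) = PowerSeries.X ^ (p + 1) := by
    rw [← hser, ← hyB]
  refine ⟨GG.card_eq p k ε, GG.isGreatest_rank p k ε hε0, ?_, ?_, GG.charB p k ε,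
    GG.charB_B p k ε, GG.charB_C p k ε, ?_, ?_, ?_⟩
  · exact lt_of_le_of_ne (Ch_le_Heven _) fun h => hnot y (h ▸ hy) hyser
  · intro hsurj
    obtain ⟨⟨x, hx⟩, hxy⟩ := hsurj ((nilrad (HGrp (GG p (k + 4) ε))).ringCon.mk' y)
    have hrel : y - x ∈ nilrad (HGrp (GG p (k + 4) ε)) :=
      (TwoSidedIdeal.rel_iff _ _ _).mp (Quotient.exact hxy.symm)
    -- a ring homomorphism to a domain kills the nilradical
    have hker : nilrad (HGrp (GG p (k + 4) ε)) ≤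
        TwoSidedIdeal.ker ((GG.seriesB p k ε).comp (res (GG.cycB p (k + 4) ε))) :=
      TwoSidedIdeal.span_le.mpr fun z hz =>
        (TwoSidedIdeal.mem_ker _).mpr (hz.map _).eq_zero
    have h0 := (TwoSidedIdeal.mem_ker _).mp (hker hrel)
    rw [map_sub, sub_eq_zero] at h0
    exact hnot x hx (h0.symm.trans hyser)
  · rw [GG.resMB_c₁]
    exact ⟨y, hy, hyB⟩
  · rw [GG.resMB_c₁]
    rintro ⟨x, hx, h⟩
    exact hnot x hx ((congrArg (GG.seriesB p k ε) h).trans hser)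
  · rw [GG.resMB_c₁]
    intro h
    have := (h.map (GG.seriesB p k ε)).eq_zero
    rw [hser] at this
    exact pow_ne_zero _ PowerSeries.X_ne_zero this
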